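/- Fix $p\in(0,\tfrac12)$, and write $\log$ for the logarithm to base $2$ and $I(p)=1+p\log p+(1-p)\log(1-p)$. In the noisy binary search problem with $n$ elements, the input consists of elements $a_1\le a_2\le\dots\le a_n$ and an element $x$ of a totally ordered set, and the goal is to output $\max(\{0\}\cup\{i\in\{1,\dots,n\}: a_i<x\})$. An algorithm has access to the input only through noisy comparisons: for any $i$ it may ask whether $a_i<x$ or whether $x<a_i$, and the truth value that it receives is flipped with probability $p$, independently for every query (queries may be repeated and chosen adaptively). Its number of comparisons need not be bounded in advance. Then there is a function $\varepsilon:\mathbb{N}\to\mathbb{R}$ (which may depend on $p$) with $\varepsilon(n)\to 0$ as $n\to\infty$ such that, for all sufficiently large $n$ and every $\delta\in(0,1)$, there exists a randomized algorithm for the noisy binary search problem with $n$ elements that, on every input, has error probability at most $\delta$ and makes at most $$(1+\varepsilon(n))\left((1-\delta)\frac{\log n}{I(p)}+\frac{2\log\frac1\delta}{(1-2p)\log\frac{1-p}{p}}\right)$$ noisy comparisons in expectation. -/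

import Mathlib

open Filter Topology
open scoped ENNReal

/-- Binary entropy in bits, `h(p) = -p log₂ p - (1-p) log₂ (1-p)`. -/
noncomputable def binaryEntropyBits (p : ℝ) : ℝ :=
  -(p * Real.logb 2 p) - (1 - p) * Real.logb 2 (1 - p)

/-- Capacity of the binary symmetric channel, `I(p) = 1 - h(p)`. -/
noncomputable def bscCapacity (p : ℝ) : ℝ := 1 - binaryEntropyBits p

/-- The binary symmetric channel with crossover probability `p`: on input `b` the output is `b` with
probability `1 - p` and `!b` with probability `p`. -/
noncomputable def binarySymmetricChannel (p : unitInterval) (b : Bool) : PMF Bool :=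
  PMF.ofFintype (fun y => if y = b then ENNReal.ofReal (1 - p) else ENNReal.ofReal p) (by
    have h : ENNReal.ofReal (1 - (p : ℝ)) + ENNReal.ofReal (p : ℝ) = 1 := by
      rw [← ENNReal.ofReal_add (by linarith [p.2.2]) p.2.1]; simp
    cases b
    · simpa [add_comm] using h
    · simpa using h)

/-- The comparisons allowed in noisy binary search on `n` sorted elements `a` with target `x`. -/
inductive SearchQuery (n : ℕ) : Type
  /-- Ask whether `a i < x`. -/
  | elementTarget (i : Fin n) : SearchQuery n
  /-- Ask whether `x < a i`. -/
  | targetElement (i : Fin n) : SearchQuery n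

/-- The noiseless answer to a comparison. -/
def SearchQuery.truth {n : ℕ} {α : Type*} [LinearOrder α] (a : Fin n → α) (x : α) :
    SearchQuery n → Bool
  | .elementTarget i => decide (a i < x)
  | .targetElement i => decide (x < a i)

/-- The required output `max ({0} ∪ {i ∈ [n] : a_i < x})`. Positions are counted from `1`, so the
element `a i` with `i : Fin n` has position `i + 1`. -/
def predecessorIndex {n : ℕ} {α : Type*} [LinearOrder α] (a : Fin n → α) (x : α) : ℕ :=
  (Finset.univ.filter fun i : Fin n => a i < x).sup fun i => (i : ℕ) + 1

/-- A randomized comparison algorithm for searching among `n` elements. It starts in a random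
internal state. The current state decides whether to make a comparison or to halt with an
output; after a comparison the new state is drawn at random, depending on the current state and
on the (noisy) answer. The number of comparisons is not bounded in advance. -/
structure RandomizedSearch (n : ℕ) where
  /-- Internal states. -/
  State : Type
  /-- Distribution of the initial state. -/
  init : PMF State
  /-- Make a comparison, or halt with an output. -/
  action : State → SearchQuery n ⊕ ℕ
  /-- Distribution of the next state, given the current state and the answer just received. -/
  next : State → Bool → PMF State

namespace RandomizedSearch

variable {n : ℕ} (A : RandomizedSearch n) {α : Type*} [LinearOrder α]

/-- One step on input `(a, x)`: a querying state receives an answer with fresh noise and moves on,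
a halted state stays where it is. -/
noncomputable def step (p : unitInterval) (a : Fin n → α) (x : α) (s : A.State) : PMF A.State :=
  match A.action s with
  | .inl q => (binarySymmetricChannel p (q.truth a x)).bind (A.next s)
  | .inr _ => PMF.pure s

/-- Distribution of the state after `t` steps. -/
noncomputable def stateAfter (p : unitInterval) (a : Fin n → α) (x : α) : ℕ → PMF A.State
  | 0 => A.init
  | t + 1 => (stateAfter p a x t).bind (A.step p a x)

/-- The expected number of comparisons: the sum over `t` of the probability that a comparison is
made in step `t`. -/
noncomputable def expectedQueries (p : unitInterval) (a : Fin n → α) (x : α) : ℝ≥0∞ :=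
  ∑' t : ℕ, (A.stateAfter p a x t).toOuterMeasure {s | ∃ q, A.action s = .inl q}

/-- The probability that the algorithm never halts with the correct output. The events
"after `t` steps it has not halted with the correct output" decrease in `t`, so the infimum is the
probability of their intersection; wrong outputs and running forever both count as errors. -/
noncomputable def errorProbability (p : unitInterval) (a : Fin n → α) (x : α) : ℝ≥0∞ :=
  ⨅ t : ℕ, (A.stateAfter p a x t).toOuterMeasure
    {s | A.action s ≠ .inr (predecessorIndex a x)}

end RandomizedSearch

/-! Let `m` be the hidden position, `r = p / (1 - p)` and `l = log n`, with logarithms to base 2.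
One round has three stages. In the first, positions carry likelihood weights, and each question is a
weighted median. Whatever is asked, an answer adds `I(p)` on average, with bounded variance, to the
log-weight of `m`. After about `l / I(p)` questions, Chebyshev's inequality puts this log-weight
within `Δ` of its mean with high probability, for any `Δ` much larger than `√l`. A balanced question
hardly changes the total weight, so few positions ever get that heavy (`exists_candidates`). In the
second, binary search with repeated questions singles out one candidate at cost `o(l)`
(`exists_search`). In the third, two gambler's-ruin tests verify it (`exists_verify`): a lead of `A`
costs about `A / (1 - 2p)` questions, and a false claim passes with probability at most `r ^ A`.
Taking `A` near `log (1/δ) / log ((1-p)/p)` gives the second term of the bound, the factor 2 coming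
from the two tests.

A round that fails verification is repeated. This happens with probability `o(1)`, so it changes
cost and error only by a factor `1 + o(1)`. The factor `1 - δ` on `log n` comes from guessing: the
rounds aim at the smaller error `δ / l`, and the rest of the error budget is spent on halting at
once, without any question, with probability close to `δ`. -/

/-- A finite decision tree whose inner nodes ask, for some `j`, whether the hidden position
exceeds `j`. -/
inductive NoisyTree (n : ℕ) (β : Type) : Type
  | leaf (b : β) : NoisyTree n β
  | ask (j : Fin n) (k : Bool → NoisyTree n β) : NoisyTree n β

/-! ### Decision trees: expectation and cost. -/

namespace NoisyTree

variable {n : ℕ} {β γ : Type}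

/-- Expectation of `f` at the leaf reached when the hidden position is `m` and every answer is
flipped with probability `p`. -/
def mean (p : ℝ) (m : ℕ) : NoisyTree n β → (β → ℝ) → ℝ
  | leaf b, f => f b
  | ask j k, f => (1 - p) * mean p m (k (decide ((j : ℕ) < m))) f
      + p * mean p m (k (!decide ((j : ℕ) < m))) f

/-- Expected number of questions when the hidden position is `m`. -/
def cost (p : ℝ) (m : ℕ) : NoisyTree n β → ℝ
  | leaf _ => 0
  | ask j k => 1 + ((1 - p) * cost p m (k (decide ((j : ℕ) < m)))
      + p * cost p m (k (!decide ((j : ℕ) < m))))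

/-- Sequential composition. -/
def bind : NoisyTree n β → (β → NoisyTree n γ) → NoisyTree n γ
  | leaf b, g => g b
  | ask j k, g => ask j fun b => bind (k b) g

/-- Every leaf satisfies `Q`. -/
def All (Q : β → Prop) : NoisyTree n β → Prop
  | leaf b => Q b
  | ask _ k => ∀ b, All Q (k b)

theorem mean_bind (p : ℝ) (m : ℕ) (t : NoisyTree n β) (g : β → NoisyTree n γ) (f : γ → ℝ) :
    (t.bind g).mean p m f = t.mean p m fun b => (g b).mean p m f := by
  induction t with
  | leaf b => rfl
  | ask j k ih => simp only [bind, mean, ih]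

theorem cost_bind (p : ℝ) (m : ℕ) (t : NoisyTree n β) (g : β → NoisyTree n γ) :
    (t.bind g).cost p m = t.cost p m + t.mean p m fun b => (g b).cost p m := by
  induction t with
  | leaf b => simp [bind, mean, cost]
  | ask j k ih => simp only [bind, mean, cost, ih]; ring

theorem mean_const (p : ℝ) (m : ℕ) (t : NoisyTree n β) (c : ℝ) :
    t.mean p m (fun _ => c) = c := by
  induction t with
  | leaf b => rfl
  | ask j k ih => simp only [mean, ih]; ring

theorem mean_add (p : ℝ) (m : ℕ) (t : NoisyTree n β) (f g : β → ℝ) :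
    t.mean p m (fun b => f b + g b) = t.mean p m f + t.mean p m g := by
  induction t with
  | leaf b => rfl
  | ask j k ih => simp only [mean, ih]; ring

theorem mean_le_mean_of_all {p : ℝ} (hp0 : 0 ≤ p) (hp1 : p ≤ 1) (m : ℕ) {Q : β → Prop}
    {t : NoisyTree n β} (ht : t.All Q) {f g : β → ℝ} (h : ∀ b, Q b → f b ≤ g b) :
    t.mean p m f ≤ t.mean p m g := by
  induction t with
  | leaf b => exact h b ht
  | ask j k ih =>
    have h1 : 0 ≤ 1 - p := by linarith
    have h2 := ih (decide ((j : ℕ) < m)) (ht _)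
    have h3 := ih (!decide ((j : ℕ) < m)) (ht _)
    simp only [mean]
    gcongr

theorem all_true (t : NoisyTree n β) : t.All fun _ => True := by
  induction t with
  | leaf b => trivial
  | ask j k ih => exact ih

theorem mean_le_mean {p : ℝ} (hp0 : 0 ≤ p) (hp1 : p ≤ 1) (m : ℕ) (t : NoisyTree n β)
    {f g : β → ℝ} (h : ∀ b, f b ≤ g b) : t.mean p m f ≤ t.mean p m g :=
  mean_le_mean_of_all hp0 hp1 m t.all_true fun b _ => h b

theorem mean_le_of_all {p : ℝ} (hp0 : 0 ≤ p) (hp1 : p ≤ 1) (m : ℕ) {Q : β → Prop}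
    {t : NoisyTree n β} (ht : t.All Q) {f : β → ℝ} {c : ℝ} (h : ∀ b, Q b → f b ≤ c) :
    t.mean p m f ≤ c :=
  (mean_le_mean_of_all hp0 hp1 m ht h).trans_eq (mean_const p m t c)

theorem mean_le {p : ℝ} (hp0 : 0 ≤ p) (hp1 : p ≤ 1) (m : ℕ) (t : NoisyTree n β) {f : β → ℝ}
    {c : ℝ} (h : ∀ b, f b ≤ c) : t.mean p m f ≤ c :=
  mean_le_of_all hp0 hp1 m t.all_true fun b _ => h b

theorem mean_nonneg {p : ℝ} (hp0 : 0 ≤ p) (hp1 : p ≤ 1) (m : ℕ) (t : NoisyTree n β) {f : β → ℝ}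
    (h : ∀ b, 0 ≤ f b) : 0 ≤ t.mean p m f :=
  (mean_const p m t 0).symm.trans_le (mean_le_mean hp0 hp1 m t h)

theorem cost_nonneg {p : ℝ} (hp0 : 0 ≤ p) (hp1 : p ≤ 1) (m : ℕ) (t : NoisyTree n β) :
    0 ≤ t.cost p m := by
  induction t with
  | leaf b => exact le_rfl
  | ask j k ih =>
    have h1 : 0 ≤ 1 - p := by linarith
    have h2 := ih (decide ((j : ℕ) < m))
    have h3 := ih (!decide ((j : ℕ) < m))
    simp only [cost]
    positivity

/-! ### Sequential tests by gambler's ruin. -/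

/-- Repeat the question `j`, at most `L` times, until the answer `v` leads by `u` (accept) or
trails by `d` (reject). -/
def walk (j : Fin n) (v : Bool) : ℕ → ℕ → ℕ → NoisyTree n Bool
  | _, 0, _ => leaf true
  | _, _ + 1, 0 => leaf false
  | 0, _ + 1, _ + 1 => leaf false
  | L + 1, u + 1, d + 1 =>
    ask j fun b => if b = v then walk j v L u (d + 2) else walk j v L (u + 2) d

theorem mean_walk_succ (p : ℝ) (m : ℕ) (j : Fin n) (v : Bool) (L u d : ℕ) (f : Bool → ℝ) :
    (walk j v (L + 1) (u + 1) (d + 1)).mean p m f =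
      if decide ((j : ℕ) < m) = v then
        (1 - p) * (walk j v L u (d + 2)).mean p m f + p * (walk j v L (u + 2) d).mean p m f
      else
        (1 - p) * (walk j v L (u + 2) d).mean p m f + p * (walk j v L u (d + 2)).mean p m f := by
  rw [walk, mean]
  cases v <;> cases decide ((j : ℕ) < m) <;> simp

theorem cost_walk_succ (p : ℝ) (m : ℕ) (j : Fin n) (v : Bool) (L u d : ℕ) :
    (walk j v (L + 1) (u + 1) (d + 1)).cost p m =
      1 + if decide ((j : ℕ) < m) = v then
        (1 - p) * (walk j v L u (d + 2)).cost p m + p * (walk j v L (u + 2) d).cost p m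
      else
        (1 - p) * (walk j v L (u + 2) d).cost p m + p * (walk j v L u (d + 2)).cost p m := by
  rw [walk, cost]
  cases v <;> cases decide ((j : ℕ) < m) <;> simp

/-- Optional stopping: each question lowers the distance `u` to acceptance by `1 - 2p` on average,
and this distance never becomes negative. -/
theorem cost_walk_of_eq {p : ℝ} (hp0 : 0 < p) (hp : p < 1 / 2) {m : ℕ} {j : Fin n} {v : Bool}
    (h : decide ((j : ℕ) < m) = v) (L u d : ℕ) :
    (walk j v L u d).cost p m ≤ u / (1 - 2 * p) := by
  have hq : 0 < 1 - 2 * p := by linarith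
  induction L generalizing u d with
  | zero => rcases u with _ | u <;> rcases d with _ | d <;> simp [walk, cost] <;> positivity
  | succ L ih =>
    rcases u with _ | u
    · simp [walk, cost]
    rcases d with _ | d
    · simp only [walk, cost]; positivity
    rw [cost_walk_succ, if_pos h]
    have h1 : 0 ≤ 1 - p := by linarith
    calc _ ≤ 1 + ((1 - p) * (u / (1 - 2 * p)) + p * ((u + 2 : ℕ) / (1 - 2 * p))) := by
          gcongr <;> apply ih
      _ = _ := by push_cast; linear_combination -div_self hq.ne'

theorem cost_walk_of_ne {p : ℝ} (hp0 : 0 < p) (hp : p < 1 / 2) {m : ℕ} {j : Fin n} {v : Bool}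
    (h : decide ((j : ℕ) < m) ≠ v) (L u d : ℕ) :
    (walk j v L u d).cost p m ≤ d / (1 - 2 * p) := by
  have hq : 0 < 1 - 2 * p := by linarith
  induction L generalizing u d with
  | zero => rcases u with _ | u <;> rcases d with _ | d <;> simp [walk, cost] <;> positivity
  | succ L ih =>
    rcases u with _ | u
    · simp only [walk, cost]; positivity
    rcases d with _ | d
    · simp [walk, cost]
    rw [cost_walk_succ, if_neg h]
    have h1 : 0 ≤ 1 - p := by linarith
    calc _ ≤ 1 + ((1 - p) * (d / (1 - 2 * p)) + p * ((d + 2 : ℕ) / (1 - 2 * p))) := by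
          gcongr <;> apply ih
      _ = _ := by push_cast; linear_combination -div_self hq.ne'

/-- Powers of the odds are harmonic for the walk that steps up with probability `1 - p` and down
with probability `p`. -/
theorem odds_pow_step {p : ℝ} (hp : p < 1) (d : ℕ) :
    (1 - p) * (p / (1 - p)) ^ (d + 2) + p * (p / (1 - p)) ^ d = (p / (1 - p)) ^ (d + 1) := by
  have h1 : 1 - p ≠ 0 := by linarith
  have h : (1 - p) * (p / (1 - p)) = p := by field_simp
  have h2 : (1 - p) * (p / (1 - p)) ^ 2 + p = p / (1 - p) := by field_simp; ring
  calc _ = (p / (1 - p)) ^ d * ((1 - p) * (p / (1 - p)) ^ 2 + p) := by ring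
    _ = _ := by rw [h2]; ring

theorem walk_accept_of_ne {p : ℝ} (hp0 : 0 < p) (hp : p < 1 / 2) {m : ℕ} {j : Fin n} {v : Bool}
    (h : decide ((j : ℕ) < m) ≠ v) (L u d : ℕ) :
    (walk j v L u d).mean p m (fun b => if b then 1 else 0) ≤ (p / (1 - p)) ^ u := by
  have h1 : 0 < 1 - p := by linarith
  induction L generalizing u d with
  | zero => rcases u with _ | u <;> rcases d with _ | d <;> simp [walk, mean] <;> positivity
  | succ L ih =>
    rcases u with _ | u
    · simp [walk, mean]
    rcases d with _ | d
    · simp only [walk, mean]; simp; positivity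
    rw [mean_walk_succ, if_neg h, ← odds_pow_step (by linarith)]
    gcongr <;> apply ih

/-- Rejection is either ruin, of probability at most `r ^ d` with `r = p / (1 - p)`, or a timeout. A
timeout means that `L` questions were asked, so by Markov's inequality its probability is at most
the cost over `L`. -/
theorem walk_reject_of_eq {p : ℝ} (hp0 : 0 < p) (hp : p < 1 / 2) {m : ℕ} {j : Fin n} {v : Bool}
    (h : decide ((j : ℕ) < m) = v) (L u d : ℕ) :
    L * (walk j v L u d).mean p m (fun b => if b then 0 else 1) ≤
      L * (p / (1 - p)) ^ d + (walk j v L u d).cost p m := by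
  have h1 : 0 < 1 - p := by linarith
  induction L generalizing u d with
  | zero => simpa using cost_nonneg hp0.le (by linarith) m _
  | succ L ih =>
    rcases u with _ | u
    · simp only [walk, mean, cost]; simp; positivity
    rcases d with _ | d
    · simp [walk, mean, cost]
    -- Passing from `L` to `L + 1` adds one copy of the rejection probability; being at most 1, it
    -- is paid for by the question just asked.
    have hle : (walk j v (L + 1) (u + 1) (d + 1)).mean p m (fun b => if b then 0 else 1) ≤ 1 :=
      mean_le hp0.le (by linarith) m _ (by intro b; cases b <;> simp)
    have hr : 0 ≤ (p / (1 - p)) ^ (d + 1) := by positivity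
    have e1 := mul_le_mul_of_nonneg_left (ih u (d + 2)) h1.le
    have e2 := mul_le_mul_of_nonneg_left (ih (u + 2) d) hp0.le
    have e3 := odds_pow_step (p := p) (by linarith) d
    have e4 := mean_walk_succ p m j v L u d (fun b => if b then 0 else 1)
    rw [if_pos h] at e4
    rw [cost_walk_succ, if_pos h]
    push_cast
    have e5 : (L : ℝ) * (walk j v (L + 1) (u + 1) (d + 1)).mean p m (fun b => if b then 0 else 1)
        ≤ L * (p / (1 - p)) ^ (d + 1) + ((1 - p) * (walk j v L u (d + 2)).cost p m
          + p * (walk j v L (u + 2) d).cost p m) := by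
      rw [e4, ← e3]; linarith
    linarith

/-- A sequential test of the claim that the truth of question `j` is `v`. -/
theorem exists_test {p : ℝ} (hp0 : 0 < p) (hp : p < 1 / 2) (j : Fin n) (v : Bool) (u d : ℕ) :
    ∃ t : NoisyTree n Bool, ∀ m : ℕ,
      (decide ((j : ℕ) < m) = v → t.cost p m ≤ u / (1 - 2 * p) ∧
        t.mean p m (fun b => if b then 0 else 1) ≤ 2 * (p / (1 - p)) ^ d) ∧
      (decide ((j : ℕ) < m) ≠ v → t.cost p m ≤ d / (1 - 2 * p) ∧
        t.mean p m (fun b => if b then 1 else 0) ≤ (p / (1 - p)) ^ u) := by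
  have h1 : 0 < 1 - p := by linarith
  have hr : 0 < (p / (1 - p)) ^ d := by positivity
  -- With this `L` the timeout probability is at most the ruin bound, hence the factor 2 for false
  -- rejection.
  obtain ⟨L, hL⟩ := exists_nat_gt (u / (1 - 2 * p) / (p / (1 - p)) ^ d)
  have hq : 0 < 1 - 2 * p := by linarith
  have hL0 : (0 : ℝ) < L := lt_of_le_of_lt (by positivity) hL
  refine ⟨walk j v L u d, fun m => ⟨fun h => ⟨cost_walk_of_eq hp0 hp h L u d, ?_⟩,
    fun h => ⟨cost_walk_of_ne hp0 hp h L u d, walk_accept_of_ne hp0 hp h L u d⟩⟩⟩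
  have h2 := walk_reject_of_eq hp0 hp h L u d
  have h3 := cost_walk_of_eq hp0 hp h L u d
  rw [div_lt_iff₀ hr] at hL
  refine le_of_mul_le_mul_left ?_ hL0
  linarith

/-! ### Balanced questions and binary search. -/

/-- A weighted median: some threshold splits the total weight evenly up to the largest weight. -/
theorem exists_balanced_split (hn : 0 < n) (w : ℕ → ℝ) (τ : ℝ) (hw : ∀ i, 0 ≤ w i)
    (hτ : ∀ i, w i ≤ τ) :
    ∃ j : Fin n, |∑ i ∈ Finset.range (n + 1), w i -
      2 * ∑ i ∈ Finset.range ((j : ℕ) + 1), w i| ≤ τ := by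
  set S := ∑ i ∈ Finset.range (n + 1), w i with hS
  -- At the first threshold whose prefix reaches half of the total, the imbalance changes sign by a
  -- jump of twice one weight, so it is at most `τ` just before or just after. If no threshold
  -- reaches half, the last one leaves only the weight of `n` above it.
  by_cases h : ∃ j, j < n ∧ S ≤ 2 * ∑ i ∈ Finset.range (j + 1), w i
  · classical
    obtain ⟨hj, hjS⟩ := Nat.find_spec h
    have hmin := fun {k} => Nat.find_min h (m := k)
    set j := Nat.find h
    rcases Nat.eq_zero_or_pos j with h0 | h0
    · refine ⟨⟨j, hj⟩, ?_⟩
      rw [abs_of_nonpos (by simpa using hjS)]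
      have : 0 ≤ S - w 0 := by
        rw [hS, Finset.sum_range_succ']
        simpa using Finset.sum_nonneg fun i _ => hw (i + 1)
      simp only [h0, zero_add, Finset.sum_range_one]
      linarith [hτ 0]
    · obtain ⟨k, hk⟩ : ∃ k, j = k + 1 := ⟨j - 1, by omega⟩
      have hk' := hmin (k := k) (by omega)
      push Not at hk'
      have hk'' := hk' (by omega)
      rw [hk, Finset.sum_range_succ] at hjS
      rcases le_total (S - 2 * ∑ i ∈ Finset.range (k + 1), w i) (w (k + 1)) with hc | hc
      · refine ⟨⟨k, by omega⟩, ?_⟩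
        rw [abs_of_nonneg (by simpa using hk''.le)]
        exact hc.trans (hτ _)
      · refine ⟨⟨j, hj⟩, ?_⟩
        simp only [hk]
        rw [Finset.sum_range_succ, abs_of_nonpos (by linarith)]
        linarith [hτ (k + 1)]
  · push Not at h
    obtain ⟨k, rfl⟩ : ∃ k, n = k + 1 := ⟨n - 1, by omega⟩
    have h2 := h k (by omega)
    refine ⟨⟨k, by omega⟩, ?_⟩
    rw [abs_of_nonneg (by simpa using h2.le), hS, Finset.sum_range_succ _ (k + 1)]
    have := Finset.sum_nonneg (s := Finset.range (k + 1)) fun i _ => hw i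
    simp only
    linarith [hτ (k + 1)]

/-- Unit weights give an imbalance of at most 1, which integrality absorbs. -/
theorem exists_even_split (hn : 0 < n) {R : Finset ℕ} (hR : R ⊆ Finset.range (n + 1)) {a : ℕ}
    (ha : R.card ≤ 2 * a) :
    ∃ j : Fin n, (R.filter fun i => (j : ℕ) < i).card ≤ a ∧
      (R.filter fun i => ¬ (j : ℕ) < i).card ≤ a := by
  classical
  obtain ⟨j, hj⟩ := exists_balanced_split hn (fun i => if i ∈ R then 1 else 0) 1
    (fun i => by split_ifs <;> norm_num) (fun i => by split_ifs <;> norm_num)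
  refine ⟨j, ?_⟩
  have e1 : Finset.range (n + 1) ∩ R = R := Finset.inter_eq_right.2 hR
  have e2 : Finset.range ((j : ℕ) + 1) ∩ R = R.filter fun i => ¬ (j : ℕ) < i := by
    ext i; simp only [Finset.mem_inter, Finset.mem_range, Finset.mem_filter]
    constructor
    · rintro ⟨h1, h2⟩; exact ⟨h2, by omega⟩
    · rintro ⟨h1, h2⟩; exact ⟨by omega, h1⟩
  rw [Finset.sum_ite_mem, Finset.sum_ite_mem, e1, e2] at hj
  simp only [Finset.sum_const, nsmul_eq_mul, mul_one] at hj
  have h3 := Finset.card_filter_add_card_filter_not (s := R) (fun i => (j : ℕ) < i)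
  rw [abs_le] at hj
  obtain ⟨h4, h5⟩ := hj
  have h4' : (2 * (R.filter fun i => ¬ (j : ℕ) < i).card : ℝ) ≤ ((R.card + 1 : ℕ) : ℝ) := by
    push_cast; linarith
  have h5' : (R.card : ℝ) ≤ ((1 + 2 * (R.filter fun i => ¬ (j : ℕ) < i).card : ℕ) : ℝ) := by
    push_cast; linarith
  norm_cast at h4' h5'
  omega

/-- Binary search inside a known set of candidates. -/
theorem exists_search {p : ℝ} (hp0 : 0 < p) (hp : p < 1 / 2) (hn : 0 < n) (B k : ℕ)
    (R : Finset ℕ) (hR : R ⊆ Finset.range (n + 1)) (hk : R.card ≤ 2 ^ k) :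
    ∃ t : NoisyTree n ℕ, (t.All fun i => i ≤ n) ∧ ∀ m : ℕ, t.cost p m ≤ k * (B / (1 - 2 * p)) ∧
      (m ∈ R → t.mean p m (fun i => if i = m then 0 else 1) ≤ k * (2 * (p / (1 - p)) ^ B)) := by
  have hp1 : 0 < 1 - p := by linarith
  have hq : 0 < 1 - 2 * p := by linarith
  induction k generalizing R with
  | zero =>
    rcases R.eq_empty_or_nonempty with rfl | ⟨a, ha⟩
    · exact ⟨leaf 0, Nat.zero_le _, fun m => by simp [cost]⟩
    · refine ⟨leaf a, Nat.lt_succ_iff.1 (Finset.mem_range.1 (hR ha)), fun m =>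
        ⟨by simp [cost], fun hm => ?_⟩⟩
      have := Finset.card_le_one.1 (by simpa using hk) a ha m hm
      simp [mean, this]
  | succ k ih =>
    obtain ⟨j, h1, h2⟩ := exists_even_split hn hR (a := 2 ^ k) (by rw [pow_succ] at hk; omega)
    obtain ⟨t, ht⟩ := exists_test hp0 hp j true B B
    obtain ⟨t1, ha1, ht1⟩ := ih _ ((Finset.filter_subset _ _).trans hR) h1
    obtain ⟨t2, ha2, ht2⟩ := ih _ ((Finset.filter_subset _ _).trans hR) h2
    refine ⟨t.bind fun b => if b then t1 else t2, ?_, fun m => ⟨?_, fun hm => ?_⟩⟩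
    · clear ht
      induction t with
      | leaf b => cases b <;> simp [bind, ha1, ha2]
      | ask j k ih => exact fun b => ih b
    · rw [cost_bind]
      have e1 : t.cost p m ≤ B / (1 - 2 * p) := by
        by_cases h : decide ((j : ℕ) < m) = true
        · exact ((ht m).1 h).1
        · exact ((ht m).2 h).1
      have e2 : (t.mean p m fun b => (if b = true then t1 else t2).cost p m)
          ≤ k * (B / (1 - 2 * p)) := by
        refine mean_le hp0.le (by linarith) m _ fun b => ?_
        cases b
        · exact (ht2 m).1
        · exact (ht1 m).1
      push_cast; linarith
    · rw [mean_bind]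
      set ζ := 2 * (p / (1 - p)) ^ B with hζ
      have hζ0 : 0 ≤ ζ := by positivity
      have key : ∀ t' : NoisyTree n ℕ,
          t'.mean p m (fun i => if i = m then 0 else 1) ≤ 1 := fun t' =>
        mean_le hp0.le (by linarith) m _ fun i => by split_ifs <;> norm_num
      have hkζ : 0 ≤ k * ζ := by positivity
      by_cases h : decide ((j : ℕ) < m) = true
      · have h3 := (ht1 m).2 (Finset.mem_filter.2 ⟨hm, by simpa using h⟩)
        calc _ ≤ t.mean p m (fun b => (if b then 0 else 1) + k * ζ) := by
              refine mean_le_mean hp0.le (by linarith) m _ fun b => ?_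
              cases b
              · simpa using (key t2).trans (by linarith)
              · simpa using h3
          _ ≤ _ := by
              rw [mean_add, mean_const]
              have := ((ht m).1 h).2
              push_cast; linarith
      · have h3 := (ht2 m).2 (Finset.mem_filter.2 ⟨hm, by simpa using h⟩)
        calc _ ≤ t.mean p m (fun b => (if b then 1 else 0) + k * ζ) := by
              refine mean_le_mean hp0.le (by linarith) m _ fun b => ?_
              cases b
              · simpa using h3
              · simpa using (key t1).trans (by linarith)
          _ ≤ _ := by
              rw [mean_add, mean_const]
              have := ((ht m).2 h).2
              push_cast; linarith

/-! ### Verification of a candidate. -/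

/-- A sequential test of the claim `i ≤ m` (`v = true`) or `m ≤ i` (`v = false`) about the hidden
position `m`. -/
theorem exists_one_sided_check {p : ℝ} (hp0 : 0 < p) (hp : p < 1 / 2) (i : ℕ) (v : Bool)
    (hi : v = true → i ≤ n) (A B : ℕ) :
    ∃ t : NoisyTree n Bool, ∀ m ≤ n,
      t.cost p m ≤ (A + B) / (1 - 2 * p) ∧
      ((if v then i ≤ m else m ≤ i) →
        t.mean p m (fun b => if b then 0 else 1) ≤ 2 * (p / (1 - p)) ^ B) ∧
      (¬ (if v then i ≤ m else m ≤ i) →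
        t.mean p m (fun b => if b then 1 else 0) ≤ (p / (1 - p)) ^ A) := by
  have hp1 : 0 < 1 - p := by linarith
  have hq : 0 < 1 - 2 * p := by linarith
  by_cases h : ∃ j : Fin n, ∀ m ≤ n, (if v then i ≤ m else m ≤ i) ↔ decide ((j : ℕ) < m) = v
  · obtain ⟨j, hj⟩ := h
    obtain ⟨t, ht⟩ := exists_test hp0 hp j v A B
    refine ⟨t, fun m hm => ?_⟩
    rw [hj m hm]
    refine ⟨?_, fun h => ((ht m).1 h).2, fun h => ((ht m).2 h).2⟩
    by_cases h : decide ((j : ℕ) < m) = v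
    · refine ((ht m).1 h).1.trans ?_
      gcongr; simp
    · refine ((ht m).2 h).1.trans ?_
      gcongr; simp
  -- A claim that no question expresses is `0 ≤ m`, or `m ≤ i` with `i ≥ n`; it is always true and
  -- needs no test.
  · have htriv : ∀ m ≤ n, if v then i ≤ m else m ≤ i := by
      intro m hm
      by_contra hc
      apply h
      cases v
      · simp only [Bool.false_eq_true, if_false, not_le] at hc
        exact ⟨⟨i, by omega⟩, fun m' hm' => by simp⟩
      · have := hi rfl
        simp only [if_true, not_le] at hc
        refine ⟨⟨i - 1, by omega⟩, fun m' hm' => ?_⟩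
        simp only [if_true, decide_eq_true_eq]
        omega
    refine ⟨leaf true, fun m hm => ⟨?_, fun _ => ?_, fun hc => (hc (htriv m hm)).elim⟩⟩
    · simp only [cost]; positivity
    · simp only [mean, if_true]; positivity

/-- Verification of a candidate position. -/
theorem exists_verify {p : ℝ} (hp0 : 0 < p) (hp : p < 1 / 2) (i : ℕ) (hi : i ≤ n) (A B : ℕ) :
    ∃ t : NoisyTree n (Option ℕ), ∀ m ≤ n,
      t.cost p m ≤ 2 * ((A + B) / (1 - 2 * p)) ∧
      (i = m → t.mean p m (fun o => if o = none then 1 else 0) ≤ 4 * (p / (1 - p)) ^ B) ∧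
      t.mean p m (fun o => if o = none ∨ o = some m then 0 else 1) ≤ (p / (1 - p)) ^ A := by
  have hp1 : 0 < 1 - p := by linarith
  have hq : 0 < 1 - 2 * p := by linarith
  obtain ⟨t1, h1⟩ := exists_one_sided_check (n := n) hp0 hp i true (fun _ => hi) A B
  obtain ⟨t2, h2⟩ := exists_one_sided_check (n := n) hp0 hp i false (fun h => by simp at h) A B
  refine ⟨t1.bind fun b => if b then t2.bind fun b' => leaf (if b' then some i else none)
    else leaf none, fun m hm => ?_⟩
  obtain ⟨c1, a1, r1⟩ := h1 m hm
  obtain ⟨c2, a2, r2⟩ := h2 m hm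
  simp only [if_true, Bool.false_eq_true, if_false] at a1 r1 a2 r2
  have hB : 0 ≤ (p / (1 - p)) ^ B := by positivity
  have hA : 0 ≤ (p / (1 - p)) ^ A := by positivity
  have hmean : ∀ f : Option ℕ → ℝ, t2.mean p m
      (fun b' => (leaf (n := n) (if b' then some i else none)).mean p m f) =
      t2.mean p m (fun b' => if b' then f (some i) else f none) := by
    intro f; congr 1; ext b'; cases b' <;> rfl
  refine ⟨?_, fun him => ?_, ?_⟩
  · rw [cost_bind]
    have : (t1.mean p m fun b => (if b = true then
        t2.bind fun b' => leaf (if b' then some i else none) else leaf none).cost p m)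
        ≤ (A + B) / (1 - 2 * p) := by
      refine mean_le hp0.le (by linarith) m _ fun b => ?_
      cases b
      · simp only [Bool.false_eq_true, if_false, cost]; positivity
      · simp only [if_true, cost_bind, cost, mean_const, add_zero]; exact c2
    linarith
  · have a1 := a1 him.le
    have a2 := a2 him.ge
    rw [mean_bind]
    calc _ ≤ t1.mean p m (fun b => (if b then 0 else 1) + 2 * (p / (1 - p)) ^ B) := by
          refine mean_le_mean hp0.le (by linarith) m _ fun b => ?_
          cases b
          · simpa [mean] using hB
          · simp only [if_true, mean_bind, hmean]
            simpa using a2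
      _ ≤ _ := by rw [mean_add, mean_const]; linarith
  · rw [mean_bind]
    -- A wrong candidate violates exactly one of the two claims, and passing the test of that claim
    -- already has probability at most `r ^ A`.
    rcases lt_trichotomy i m with h | h | h
    · have r2 := r2 (by omega)
      refine mean_le hp0.le (by linarith) m _ fun b => ?_
      cases b
      · simpa [mean] using hA
      · simp only [if_true, mean_bind, hmean]
        simpa [h.ne] using r2
    · refine (mean_le hp0.le (by linarith) m _ (c := 0) fun b => ?_).trans hA
      cases b
      · simp [mean]
      · simp only [if_true, mean_bind, hmean]
        simp [h, mean_const]
    · have r1 := r1 (by omega)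
      refine le_trans (mean_le_mean hp0.le (by linarith) m _ fun b => ?_) r1
      cases b
      · simp [mean]
      · simp only [if_true, mean_bind, hmean]
        refine mean_le hp0.le (by linarith) m _ fun b' => ?_
        split_ifs <;> norm_num

/-! ### Multiplicative weights. -/

/-- The factor by which the weight of position `i` is multiplied after the answer `b` to
question `j`. -/
noncomputable def likelihood (p : ℝ) (j : ℕ) (b : Bool) (i : ℕ) : ℝ :=
  if decide (j < i) = b then 2 * (1 - p) else 2 * p

/-- Either answer changes the total weight by exactly `1 - 2p` times the imbalance, up to sign. The
bound thus holds for every answer, not merely on average. -/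
theorem sum_mul_likelihood_le {p τ : ℝ} (hp0 : 0 < p) (hp : p < 1 / 2) {j : ℕ}
    (hj : j < n) (b : Bool) (W : ℕ → ℝ)
    (h : |∑ i ∈ Finset.range (n + 1), W i - 2 * ∑ i ∈ Finset.range (j + 1), W i| ≤ τ) :
    ∑ i ∈ Finset.range (n + 1), W i * likelihood p j b i ≤
      ∑ i ∈ Finset.range (n + 1), W i + τ := by
  have h1 : ∑ i ∈ Finset.range (j + 1), W i =
      ∑ i ∈ Finset.range (n + 1), if j < i then 0 else W i := by
    rw [← Finset.sum_subset (s₁ := Finset.range (j + 1)) (s₂ := Finset.range (n + 1))]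
    · refine Finset.sum_congr rfl fun i hi => ?_
      rw [Finset.mem_range] at hi
      rw [if_neg (by omega)]
    · intro i hi
      simp only [Finset.mem_range] at *
      omega
    · intro i _ hi
      simp only [Finset.mem_range] at *
      rw [if_pos (by omega)]
  have h2 : ∑ i ∈ Finset.range (n + 1), W i * likelihood p j b i =
      ∑ i ∈ Finset.range (n + 1), W i + (if b then (1 - 2 * p) else -(1 - 2 * p)) *
      (∑ i ∈ Finset.range (n + 1), W i - 2 * ∑ i ∈ Finset.range (j + 1), W i) := by
    rw [h1, Finset.mul_sum, ← Finset.sum_sub_distrib, Finset.mul_sum, ← Finset.sum_add_distrib]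
    refine Finset.sum_congr rfl fun i _ => ?_
    unfold likelihood
    by_cases hc : j < i <;> cases b <;> simp [hc] <;> ring
  rw [h2]
  rw [abs_le] at h
  cases b
  · simp only [Bool.false_eq_true, if_false]; nlinarith
  · simp only [if_true]; nlinarith

/-- The log-weight increment has mean `bscCapacity p` and variance equal to the last summand: the
bias and variance decomposition of one step. -/
theorem logb_likelihood_variance {p : ℝ} (y c : ℝ) (T : ℕ) :
    (1 - p) * ((y + (1 + Real.logb 2 (1 - p)) + T * bscCapacity p - c) ^ 2) +
      p * ((y + (1 + Real.logb 2 p) + T * bscCapacity p - c) ^ 2) =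
    (y + (T + 1 : ℕ) * bscCapacity p - c) ^ 2 +
      p * (1 - p) * (Real.logb 2 (1 - p) - Real.logb 2 p) ^ 2 := by
  unfold bscCapacity binaryEntropyBits
  push_cast
  ring

/-- Multiplicative weights: `T` questions reduce the positions to a set of candidates. A position
becomes a candidate once its weight reaches `τ`. -/
theorem exists_candidates {p τ c Δ : ℝ} (hp0 : 0 < p) (hp : p < 1 / 2) (hn : 0 < n)
    (hτ : 0 < τ) (hΔ : 0 < Δ) (hc : Real.logb 2 τ = c - Δ) (T : ℕ) (w : ℕ → ℝ) (R : Finset ℕ)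
    (hw : ∀ i, 0 < w i) (hR : R ⊆ Finset.range (n + 1))
    (hwτ : ∀ i ∈ Finset.range (n + 1) \ R, w i < τ) :
    ∃ t : NoisyTree n (Finset ℕ),
      (t.All fun R' => R ⊆ R' ∧ R' ⊆ Finset.range (n + 1) ∧
        R'.card * τ ≤ R.card * τ + ∑ i ∈ Finset.range (n + 1) \ R, w i + T * τ) ∧
      ∀ m ≤ n, t.cost p m = T ∧ (m ∉ R → t.mean p m (fun R' => if m ∈ R' then 0 else 1) ≤
        ((Real.logb 2 (w m) + T * bscCapacity p - c) ^ 2 +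
          T * (p * (1 - p) * (Real.logb 2 (1 - p) - Real.logb 2 p) ^ 2)) / Δ ^ 2) := by
  have hp1 : 0 < 1 - p := by linarith
  have hl : ∀ j b i, 0 < likelihood p j b i := by
    intro j b i; unfold likelihood; split_ifs <;> positivity
  set s := p * (1 - p) * (Real.logb 2 (1 - p) - Real.logb 2 p) ^ 2 with hs
  have hs0 : 0 ≤ s := by positivity
  induction T generalizing w R with
  | zero =>
    refine ⟨leaf R, ⟨subset_rfl, hR, ?_⟩, fun m hm => ⟨by simp [cost], fun hmR => ?_⟩⟩
    · have := Finset.sum_nonneg (s := Finset.range (n + 1) \ R) fun i _ => (hw i).le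
      simpa using this
    -- A position that is still no candidate has log-weight below `c - Δ`, so its squared deviation
    -- from `c` exceeds `Δ ^ 2`. This is Chebyshev's inequality; the induction step propagates the
    -- second moment backwards.
    · have h1 := hwτ m (by simp [hmR]; omega)
      have h2 := Real.logb_lt_logb one_lt_two (hw m) h1
      simp only [mean, if_neg hmR]
      rw [one_le_div (by positivity)]
      simp only [Nat.cast_zero, zero_mul, add_zero]
      nlinarith
  | succ T ih =>
    have hsum : ∀ f : ℕ → ℝ, ∑ i ∈ Finset.range (n + 1) \ R, f i =
        ∑ i ∈ Finset.range (n + 1), if i ∈ R then 0 else f i := by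
      intro f
      rw [Finset.sum_ite, Finset.sum_const_zero, zero_add, Finset.sdiff_eq_filter]
    obtain ⟨j, hj⟩ := exists_balanced_split hn
      (fun i => if i ∈ Finset.range (n + 1) \ R then w i else 0) τ
      (fun i => by split_ifs <;> simp [(hw i).le])
      (fun i => by
        split_ifs with h
        · exact (hwτ i h).le
        · exact hτ.le)
    have hupd : ∀ b, ∑ i ∈ Finset.range (n + 1) \ R, w i * likelihood p j b i ≤
        ∑ i ∈ Finset.range (n + 1) \ R, w i + τ := by
      intro b
      have := sum_mul_likelihood_le hp0 hp j.2 b _ hj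
      simp only [ite_mul, zero_mul] at this
      rw [Finset.sum_ite_mem, Finset.sum_ite_mem,
        Finset.inter_eq_right.2 Finset.sdiff_subset] at this
      exact this
    set N : Bool → Finset ℕ := fun b =>
      (Finset.range (n + 1) \ R).filter fun i => τ ≤ w i * likelihood p j b i with hN
    have hNR : ∀ b, Disjoint R (N b) := fun b =>
      Finset.disjoint_of_subset_right (Finset.filter_subset _ _) Finset.disjoint_sdiff
    have hsd : ∀ b, Finset.range (n + 1) \ (R ∪ N b) =
        (Finset.range (n + 1) \ R).filter fun i => ¬ τ ≤ w i * likelihood p j b i := by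
      intro b; ext i
      simp only [hN, Finset.mem_sdiff, Finset.mem_union, Finset.mem_filter]
      tauto
    choose t ht1 ht2 using fun b => ih (fun i => w i * likelihood p j b i) (R ∪ N b)
      (fun i => mul_pos (hw i) (hl _ _ _))
      (Finset.union_subset hR ((Finset.filter_subset _ _).trans Finset.sdiff_subset))
      (fun i hi => by
        rw [hsd] at hi
        exact not_le.1 (Finset.mem_filter.1 hi).2)
    -- A promoted position takes at least `τ` out of the remaining weight, which pays for its place
    -- in the count. So the potential grows only by the imbalance, at most `τ` per question.
    have hinv : ∀ b, ((R ∪ N b).card : ℝ) * τ +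
        ∑ i ∈ Finset.range (n + 1) \ (R ∪ N b), w i * likelihood p j b i ≤
        R.card * τ + ∑ i ∈ Finset.range (n + 1) \ R, w i + τ := by
      intro b
      rw [Finset.card_union_of_disjoint (hNR b), hsd]
      have h1 := Finset.sum_filter_add_sum_filter_not (Finset.range (n + 1) \ R)
        (fun i => τ ≤ w i * likelihood p j b i) (fun i => w i * likelihood p j b i)
      have h2 : ((N b).card : ℝ) * τ ≤ ∑ i ∈ N b, w i * likelihood p j b i := by
        rw [← nsmul_eq_mul]
        exact Finset.card_nsmul_le_sum _ _ _ fun i hi => (Finset.mem_filter.1 hi).2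
      have h3 := hupd b
      push_cast
      linarith
    have hmono : ∀ {Q Q' : Finset ℕ → Prop} (t : NoisyTree n (Finset ℕ)), (∀ R, Q R → Q' R) →
        t.All Q → t.All Q' := by
      intro Q Q' t h
      induction t with
      | leaf b => exact h b
      | ask j k ih => exact fun hk b => ih b (hk b)
    refine ⟨ask j t, fun b => hmono _ ?_ (ht1 b), fun m hm => ⟨?_, fun hmR => ?_⟩⟩
    · rintro R' ⟨h1, h2, h3⟩
      refine ⟨Finset.union_subset_left h1, h2, ?_⟩
      have := hinv b
      push_cast
      linarith
    · simp only [cost, (ht2 _ m hm).1]; push_cast; ring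
    · have hb : ∀ b, (t b).mean p m (fun R' => if m ∈ R' then 0 else 1) ≤
          ((Real.logb 2 (w m * likelihood p j b m) + T * bscCapacity p - c) ^ 2 + T * s)
            / Δ ^ 2 := by
        intro b
        by_cases hmN : m ∈ R ∪ N b
        · refine (mean_le_of_all hp0.le (by linarith) m (ht1 b) (c := 0) fun R' h => ?_).trans
            (by positivity)
          rw [if_pos (h.1 hmN)]
        · exact (ht2 b m hm).2 hmN
      have h1 := hb (decide ((j : ℕ) < m))
      have h2 := hb (!decide ((j : ℕ) < m))
      have e1 : likelihood p j (decide ((j : ℕ) < m)) m = 2 * (1 - p) := by simp [likelihood]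
      have e2 : likelihood p j (!decide ((j : ℕ) < m)) m = 2 * p := by simp [likelihood]
      rw [e1, Real.logb_mul (hw m).ne' (by positivity), Real.logb_mul two_ne_zero hp1.ne',
        Real.logb_self_eq_one one_lt_two] at h1
      rw [e2, Real.logb_mul (hw m).ne' (by positivity), Real.logb_mul two_ne_zero hp0.ne',
        Real.logb_self_eq_one one_lt_two] at h2
      have h3 := logb_likelihood_variance (p := p) (Real.logb 2 (w m)) c T
      rw [← hs] at h3
      simp only [mean]
      calc _ ≤ (1 - p) * (((Real.logb 2 (w m) + (1 + Real.logb 2 (1 - p)) + T * bscCapacity p - c)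
              ^ 2 + T * s) / Δ ^ 2) + p * (((Real.logb 2 (w m) + (1 + Real.logb 2 p) +
              T * bscCapacity p - c) ^ 2 + T * s) / Δ ^ 2) := by gcongr
        _ = _ := by
          push_cast at h3 ⊢
          rw [← mul_div_assoc, ← mul_div_assoc, ← add_div]
          congr 1
          linear_combination h3

/-! ### One complete round. -/

/-- One attempt at the search: it fails (`none`) rarely and answers wrongly very rarely. -/
theorem exists_round {p Δ : ℝ} (hp0 : 0 < p) (hp : p < 1 / 2) (hn : 0 < n) (hΔ : 0 < Δ)
    (A B T k : ℕ) (hΔT : Δ < T * bscCapacity p)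
    (hk : (n + 1) / (2 : ℝ) ^ (T * bscCapacity p - Δ) + T ≤ 2 ^ k) :
    ∃ t : NoisyTree n (Option ℕ), ∀ m ≤ n,
      t.cost p m ≤ T + k * (B / (1 - 2 * p)) + 2 * ((A + B) / (1 - 2 * p)) ∧
      t.mean p m (fun o => if o = none then 1 else 0) ≤
        T * (p * (1 - p) * (Real.logb 2 (1 - p) - Real.logb 2 p) ^ 2) / Δ ^ 2 +
          (2 * k + 4) * (p / (1 - p)) ^ B ∧
      t.mean p m (fun o => if o = none ∨ o = some m then 0 else 1) ≤ (p / (1 - p)) ^ A := by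
  have hp1 : 0 < 1 - p := by linarith
  have hq : 0 < 1 - 2 * p := by linarith
  set τ := (2 : ℝ) ^ (T * bscCapacity p - Δ) with hτ
  have hτ1 : 1 < τ := Real.one_lt_rpow one_lt_two (by linarith)
  -- All weights start at 1, so centring at `c = T * bscCapacity p` makes the bias zero and leaves
  -- only the variance.
  obtain ⟨t0, hall, h0⟩ := exists_candidates (n := n) (c := T * bscCapacity p) hp0 hp hn
    (by linarith : 0 < τ) hΔ (by rw [hτ, Real.logb_rpow two_pos (by norm_num)]) T (fun _ => 1) ∅
    (fun _ => one_pos) (Finset.empty_subset _) (fun _ _ => hτ1)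
  have hs : ∀ R : Finset ℕ, ∃ t : NoisyTree n ℕ, (t.All fun i => i ≤ n) ∧
      (R ⊆ Finset.range (n + 1) → R.card ≤ 2 ^ k → ∀ m : ℕ, t.cost p m ≤ k * (B / (1 - 2 * p)) ∧
      (m ∈ R → t.mean p m (fun i => if i = m then 0 else 1) ≤ k * (2 * (p / (1 - p)) ^ B))) := by
    intro R
    by_cases h : R ⊆ Finset.range (n + 1) ∧ R.card ≤ 2 ^ k
    · obtain ⟨t, h1, h2⟩ := exists_search hp0 hp hn B k R h.1 h.2
      exact ⟨t, h1, fun _ _ => h2⟩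
    -- An arbitrary value: the first stage never produces such a set.
    · exact ⟨leaf 0, Nat.zero_le _, fun h1 h2 => (h ⟨h1, h2⟩).elim⟩
  choose ts hts0 hts using hs
  have hv : ∀ i : ℕ, ∃ t : NoisyTree n (Option ℕ), i ≤ n → ∀ m ≤ n,
      t.cost p m ≤ 2 * ((A + B) / (1 - 2 * p)) ∧
      (i = m → t.mean p m (fun o => if o = none then 1 else 0) ≤ 4 * (p / (1 - p)) ^ B) ∧
      t.mean p m (fun o => if o = none ∨ o = some m then 0 else 1) ≤ (p / (1 - p)) ^ A := by
    intro i
    by_cases h : i ≤ n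
    · obtain ⟨t, ht⟩ := exists_verify hp0 hp i h A B
      exact ⟨t, fun _ => ht⟩
    · exact ⟨leaf none, fun h' => (h h').elim⟩
  choose tv htv using hv
  refine ⟨t0.bind fun R => (ts R).bind tv, fun m hm => ?_⟩
  have hcard : ∀ R' : Finset ℕ, (R'.card : ℝ) * τ ≤ (∅ : Finset ℕ).card * τ +
      ∑ i ∈ Finset.range (n + 1) \ ∅, (1 : ℝ) + T * τ → R'.card ≤ 2 ^ k := by
    intro R' h
    simp only [Finset.card_empty, Nat.cast_zero, zero_mul, zero_add, Finset.sdiff_empty,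
      Finset.sum_const, Finset.card_range, nsmul_eq_mul, mul_one, Nat.cast_add,
      Nat.cast_one] at h
    have h1 : (R'.card : ℝ) ≤ (n + 1) / τ + T := by
      rw [← mul_le_mul_iff_left₀ (by linarith : 0 < τ), add_mul, div_mul_cancel₀ _ (by linarith)]
      exact h
    exact_mod_cast h1.trans hk
  obtain ⟨c0, f0⟩ := h0 m hm
  have f0 := f0 (Finset.notMem_empty m)
  rw [Real.logb_one, zero_add, sub_self, zero_pow two_ne_zero, zero_add] at f0
  have hB : 0 ≤ (p / (1 - p)) ^ B := by positivity
  refine ⟨?_, ?_, ?_⟩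
  · rw [cost_bind, c0, add_assoc]
    gcongr
    refine mean_le_of_all hp0.le (by linarith) m hall fun R ⟨_, h1, h2⟩ => ?_
    rw [cost_bind]
    refine add_le_add (hts R h1 (hcard R h2) m).1 ?_
    exact mean_le_of_all hp0.le (by linarith) m (hts0 R) fun i hi => (htv i hi m hm).1
  · rw [mean_bind]
    calc _ ≤ t0.mean p m (fun R => (if m ∈ R then 0 else 1) +
          (2 * k + 4) * (p / (1 - p)) ^ B) := by
          refine mean_le_mean_of_all hp0.le (by linarith) m hall fun R ⟨_, h1, h2⟩ => ?_
          rw [mean_bind]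
          by_cases hmR : m ∈ R
          · have h3 := (hts R h1 (hcard R h2) m).2 hmR
            rw [if_pos hmR, zero_add]
            calc _ ≤ (ts R).mean p m (fun i => (if i = m then 0 else 1) +
                  4 * (p / (1 - p)) ^ B) := by
                  refine mean_le_mean_of_all hp0.le (by linarith) m (hts0 R) fun i hi => ?_
                  by_cases him : i = m
                  · rw [if_pos him, zero_add]
                    exact (htv i hi m hm).2.1 him
                  · rw [if_neg him]
                    have := mean_le hp0.le (by linarith) m (tv i)
                      (f := fun o => if o = none then 1 else 0) (c := 1)
                      fun o => by split_ifs <;> norm_num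
                    linarith
              _ ≤ _ := by rw [mean_add, mean_const]; linarith
          · rw [if_neg hmR]
            have h4 := mean_le hp0.le (by linarith) m (ts R)
              (f := fun i => (tv i).mean p m fun o => if o = none then 1 else 0) (c := 1)
              fun i => mean_le hp0.le (by linarith) m _ fun o => by split_ifs <;> norm_num
            have : 0 ≤ (2 * k + 4) * (p / (1 - p)) ^ B := by positivity
            linarith
      _ ≤ _ := by rw [mean_add, mean_const]; linarith
  · rw [mean_bind]
    refine mean_le hp0.le (by linarith) m _ fun R => ?_
    rw [mean_bind]
    exact mean_le_of_all hp0.le (by linarith) m (hts0 R) fun i hi => (htv i hi m hm).2.2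

end NoisyTree

/-! ### Expectations and potentials for randomized algorithms. -/

namespace PMF

variable {σ τ : Type*}

/-- Expectation of an extended nonnegative function. -/
noncomputable def expect (μ : PMF σ) (V : σ → ℝ≥0∞) : ℝ≥0∞ := ∑' s, μ s * V s

theorem expect_bind (μ : PMF σ) (f : σ → PMF τ) (V : τ → ℝ≥0∞) :
    (μ.bind f).expect V = μ.expect fun s => (f s).expect V := by
  simp only [expect, bind_apply, ← ENNReal.tsum_mul_right, ← ENNReal.tsum_mul_left]
  rw [ENNReal.tsum_comm]
  simp only [mul_assoc]

theorem expect_pure (s : σ) (V : σ → ℝ≥0∞) : (pure s).expect V = V s := by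
  classical
  rw [expect, tsum_eq_single s]
  · simp
  · intro s' h; simp [h]

theorem expect_mono (μ : PMF σ) {V W : σ → ℝ≥0∞} (h : ∀ s, V s ≤ W s) :
    μ.expect V ≤ μ.expect W :=
  ENNReal.tsum_le_tsum fun s => by gcongr; exact h s

theorem expect_add (μ : PMF σ) (V W : σ → ℝ≥0∞) :
    (μ.expect fun s => V s + W s) = μ.expect V + μ.expect W := by
  simp only [expect, mul_add, ENNReal.tsum_add]

theorem toOuterMeasure_eq_expect (μ : PMF σ) (S : Set σ) :
    μ.toOuterMeasure S = μ.expect (S.indicator 1) := by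
  rw [toOuterMeasure_apply]
  refine tsum_congr fun s => ?_
  by_cases h : s ∈ S <;> simp [h]

theorem expect_binarySymmetricChannel (p : unitInterval) (b : Bool) (V : Bool → ℝ≥0∞) :
    (binarySymmetricChannel p b).expect V =
      ENNReal.ofReal (1 - p) * V b + ENNReal.ofReal p * V (!b) := by
  cases b <;> simp [expect, binarySymmetricChannel, add_comm]

end PMF

namespace RandomizedSearch

variable {n : ℕ} (A : RandomizedSearch n) {α : Type*} [LinearOrder α]

/-- A potential that decreases by `1` in expectation with each comparison bounds the expected
number of comparisons. -/
theorem expectedQueries_le_expect (p : unitInterval) (a : Fin n → α) (x : α) (V : A.State → ℝ≥0∞)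
    (hV : ∀ s q, A.action s = .inl q → 1 + (A.step p a x s).expect V ≤ V s) :
    A.expectedQueries p a x ≤ A.init.expect V := by
  have hstep : ∀ t, (A.stateAfter p a x t).toOuterMeasure {s | ∃ q, A.action s = .inl q} +
      (A.stateAfter p a x (t + 1)).expect V ≤ (A.stateAfter p a x t).expect V := by
    intro t
    rw [PMF.toOuterMeasure_eq_expect, stateAfter, PMF.expect_bind, ← PMF.expect_add]
    refine PMF.expect_mono _ fun s => ?_
    rcases h : A.action s with q | i
    · rw [Set.indicator_of_mem (by exact ⟨q, h⟩)]
      exact hV s q h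
    · rw [Set.indicator_of_notMem (by simp [h]), step, h, zero_add, PMF.expect_pure]
  have hsum : ∀ T, ∑ t ∈ Finset.range T,
      (A.stateAfter p a x t).toOuterMeasure {s | ∃ q, A.action s = .inl q} +
      (A.stateAfter p a x T).expect V ≤ A.init.expect V := by
    intro T
    induction T with
    | zero => simp [stateAfter]
    | succ T ih =>
      rw [Finset.sum_range_succ, add_assoc]
      exact (add_le_add_right (hstep T) _).trans ih
  rw [expectedQueries, ENNReal.tsum_eq_iSup_nat]
  exact iSup_le fun T => le_self_add.trans (hsum T)

/-- If the algorithm halts almost surely, a nonnegative supermartingale that is at least `1` at the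
wrong outputs bounds the error probability. -/
theorem errorProbability_le_expect (p : unitInterval) (a : Fin n → α) (x : α)
    (hfin : A.expectedQueries p a x ≠ ∞) (U : A.State → ℝ≥0∞)
    (hU : ∀ s q, A.action s = .inl q → (A.step p a x s).expect U ≤ U s)
    (hwrong : ∀ s i, A.action s = .inr i → i ≠ predecessorIndex a x → 1 ≤ U s) :
    A.errorProbability p a x ≤ A.init.expect U := by
  have hexp : ∀ t, (A.stateAfter p a x t).expect U ≤ A.init.expect U := by
    intro t
    induction t with
    | zero => exact le_rfl
    | succ t ih =>
      refine le_trans ?_ ih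
      rw [stateAfter, PMF.expect_bind]
      refine PMF.expect_mono _ fun s => ?_
      rcases h : A.action s with q | i
      · exact hU s q h
      · rw [step, h, PMF.expect_pure]
  have hlim := ENNReal.tendsto_atTop_zero_of_tsum_ne_top hfin
  -- At time `t` an error means still running or halted wrongly. The first probability is a term of
  -- a convergent series, so it tends to zero.
  have hle : ∀ t, A.errorProbability p a x ≤
      (A.stateAfter p a x t).toOuterMeasure {s | ∃ q, A.action s = .inl q} + A.init.expect U := by
    intro t
    refine (iInf_le _ t).trans ?_
    refine le_trans ?_ (add_le_add_right (hexp t) _)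
    rw [PMF.toOuterMeasure_eq_expect, PMF.toOuterMeasure_eq_expect, ← PMF.expect_add]
    refine PMF.expect_mono _ fun s => ?_
    rcases h : A.action s with q | i
    · rw [Set.indicator_of_mem (s := {s | ∃ q, A.action s = .inl q}) (by exact ⟨q, h⟩)]
      exact (Set.indicator_le_self' (fun _ _ => zero_le) s).trans le_self_add
    · by_cases hi : i = predecessorIndex a x
      · rw [Set.indicator_of_notMem (by simp [h, hi])]
        exact zero_le
      · rw [Set.indicator_of_mem (by simp [h, hi])]
        exact (hwrong s i h hi).trans le_add_self
  have := ge_of_tendsto' (hlim.add_const (A.init.expect U)) hle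
  simpa using this

end RandomizedSearch

/-! ### From trees to algorithms with restarts. -/

theorem predecessorIndex_le {n : ℕ} {α : Type*} [LinearOrder α] (a : Fin n → α) (x : α) :
    predecessorIndex a x ≤ n :=
  Finset.sup_le fun i _ => i.2

/-- Sortedness turns a comparison with `a j` into a threshold question about the hidden position,
the only kind that a tree asks. -/
theorem lt_predecessorIndex_iff {n : ℕ} {α : Type*} [LinearOrder α] {a : Fin n → α}
    (ha : Monotone a) (x : α) (j : Fin n) : (j : ℕ) < predecessorIndex a x ↔ a j < x := by
  rw [predecessorIndex, Finset.lt_sup_iff]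
  constructor
  · rintro ⟨i, hi, hji⟩
    exact (ha (Fin.le_def.2 (Nat.lt_succ_iff.1 hji))).trans_lt (Finset.mem_filter.1 hi).2
  · intro h
    exact ⟨j, by simpa using h, Nat.lt_succ_self _⟩

namespace NoisyTree

variable {n : ℕ}

/-- Halt at once with probability `q`, otherwise follow the tree `ask j k`, starting afresh
whenever a leaf `none` is reached. -/
noncomputable def restart (q : unitInterval) (j : Fin n)
    (k : Bool → NoisyTree n (Option ℕ)) : RandomizedSearch n where
  State := NoisyTree n (Option ℕ)
  init := (binarySymmetricChannel q true).bind fun b =>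
    PMF.pure (if b then ask j k else leaf (some 0))
  action
    | leaf (some i) => .inr i
    | leaf none => .inl (.elementTarget j)
    | ask j' _ => .inl (.elementTarget j')
  next
    | leaf (some i), _ => PMF.pure (leaf (some i))
    | leaf none, b => PMF.pure (k b)
    | ask _ k', b => PMF.pure (k' b)

theorem expect_init_restart (q : unitInterval) (j : Fin n) (k : Bool → NoisyTree n (Option ℕ))
    (V : NoisyTree n (Option ℕ) → ℝ≥0∞) :
    (restart q j k).init.expect V =
      ENNReal.ofReal (1 - q) * V (ask j k) + ENNReal.ofReal q * V (leaf (some 0)) := by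
  change PMF.expect (PMF.bind _ _) V = _
  rw [PMF.expect_bind, PMF.expect_binarySymmetricChannel]
  simp [PMF.expect_pure]

section

variable {α : Type*} [LinearOrder α] {a : Fin n → α}

theorem expect_step_restart_ask (p q : unitInterval) (j : Fin n)
    (k : Bool → NoisyTree n (Option ℕ)) (ha : Monotone a) (x : α)
    (j' : Fin n) (k' : Bool → NoisyTree n (Option ℕ)) (v : NoisyTree n (Option ℕ) → ℝ)
    (hv : ∀ s, 0 ≤ v s) :
    ((restart q j k).step p a x (ask j' k')).expect (fun s => ENNReal.ofReal (v s)) =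
      ENNReal.ofReal ((1 - p) * v (k' (decide ((j' : ℕ) < predecessorIndex a x))) +
        p * v (k' (!decide ((j' : ℕ) < predecessorIndex a x)))) := by
  have h1 : 0 ≤ 1 - (p : ℝ) := by linarith [p.2.2]
  change PMF.expect (PMF.bind _ fun b => (PMF.pure (k' b) : PMF (NoisyTree n (Option ℕ))))
    (fun s : NoisyTree n (Option ℕ) => ENNReal.ofReal (v s)) = _
  simp only [PMF.expect_bind, PMF.expect_binarySymmetricChannel, PMF.expect_pure,
    SearchQuery.truth, lt_predecessorIndex_iff ha]
  rw [ENNReal.ofReal_add (mul_nonneg h1 (hv _)) (mul_nonneg p.2.1 (hv _)),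
    ENNReal.ofReal_mul h1, ENNReal.ofReal_mul p.2.1]

/-- The potential is the remaining cost of the current round plus the probability of its failure
times `G`, where `G = C + φ * G` bounds the cost of all rounds from a fresh start. -/
theorem restart_expectedQueries_le {p q : unitInterval} {j : Fin n}
    {k : Bool → NoisyTree n (Option ℕ)} (ha : Monotone a) (x : α) {C φ : ℝ}
    (hφ : φ < 1) (hC : (ask j k).cost p (predecessorIndex a x) ≤ C)
    (hnone : (ask j k).mean p (predecessorIndex a x) (fun o => if o = none then 1 else 0) ≤ φ) :
    (restart q j k).expectedQueries p a x ≤ ENNReal.ofReal ((1 - q) * (C / (1 - φ))) := by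
  set m := predecessorIndex a x with hm
  have hp0 := p.2.1
  have hp1 := p.2.2
  have hφ' : 0 < 1 - φ := by linarith
  have hC0 : 0 ≤ C := (cost_nonneg hp0 hp1 m _).trans hC
  set G := C / (1 - φ) with hG
  have hG0 : 0 ≤ G := by positivity
  have hGC : G = C + φ * G := by rw [hG]; field_simp; ring
  set v : NoisyTree n (Option ℕ) → ℝ := fun s =>
    s.cost p m + s.mean p m (fun o => if o = none then 1 else 0) * G with hv
  have hv0 : ∀ s, 0 ≤ v s := fun s => add_nonneg (cost_nonneg hp0 hp1 m _)
    (mul_nonneg (mean_nonneg hp0 hp1 m _ fun o => by split_ifs <;> norm_num) hG0)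
  have hroot : v (ask j k) ≤ G := by
    rw [hGC]; simp only [hv]; gcongr
  have hask : ∀ j' k', v (ask j' k') = 1 + ((1 - p) * v (k' (decide ((j' : ℕ) < m))) +
        p * v (k' (!decide ((j' : ℕ) < m)))) := by
    intro j' k'; simp only [hv, cost, mean]; ring
  have hp1' : 0 ≤ 1 - (p : ℝ) := by linarith
  have hstep : ∀ j' k', 1 + ((restart q j k).step p a x (ask j' k')).expect
      (fun s => ENNReal.ofReal (v s)) = ENNReal.ofReal (v (ask j' k')) := by
    intro j' k'
    rw [expect_step_restart_ask p q j k ha x j' k' v hv0, hask, ENNReal.ofReal_add zero_le_one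
      (add_nonneg (mul_nonneg hp1' (hv0 _)) (mul_nonneg hp0 (hv0 _))), ENNReal.ofReal_one]
  refine ((restart q j k).expectedQueries_le_expect p a x (fun s => ENNReal.ofReal (v s))
    ?_).trans ?_
  · rintro (o | ⟨j', k'⟩) r hr
    · rcases o with _ | i
      -- A failed leaf asks the root question itself, so it steps exactly as the root does, and its
      -- potential `G` dominates that of the root.
      · refine (hstep j k).trans_le ?_
        refine ENNReal.ofReal_le_ofReal (hroot.trans_eq ?_)
        simp [hv, cost, mean]
      · cases hr
    · exact (hstep j' k').le
  · refine (expect_init_restart q j k _).trans_le ?_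
    have h0 : v (leaf (some 0)) = 0 := by simp [hv, cost, mean]
    simp only [h0, ENNReal.ofReal_zero, mul_zero, add_zero]
    have hq : 0 ≤ 1 - (q : ℝ) := by linarith [q.2.2]
    rw [← ENNReal.ofReal_mul hq]
    exact ENNReal.ofReal_le_ofReal (by gcongr)

/-- The potential of the cost bound, with the probability of a wrong answer in place of the cost. An
immediate halt is counted as an error. -/
theorem restart_errorProbability_le {p q : unitInterval} {j : Fin n}
    {k : Bool → NoisyTree n (Option ℕ)} (ha : Monotone a) (x : α) {e φ : ℝ}
    (hφ : φ < 1)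
    (hnone : (ask j k).mean p (predecessorIndex a x) (fun o => if o = none then 1 else 0) ≤ φ)
    (he : (ask j k).mean p (predecessorIndex a x)
      (fun o => if o = none ∨ o = some (predecessorIndex a x) then 0 else 1) ≤ e) :
    (restart q j k).errorProbability p a x ≤ ENNReal.ofReal ((1 - q) * (e / (1 - φ)) + q) := by
  have hfin : (restart q j k).expectedQueries p a x ≠ ∞ :=
    ne_top_of_le_ne_top ENNReal.ofReal_ne_top (restart_expectedQueries_le ha x hφ le_rfl hnone)
  set m := predecessorIndex a x with hm
  have hp0 := p.2.1
  have hp1 := p.2.2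
  have hφ' : 0 < 1 - φ := by linarith
  have hind : ∀ o : Option ℕ, (0 : ℝ) ≤ if o = none ∨ o = some m then 0 else 1 :=
    fun o => by split_ifs <;> norm_num
  have he0 : 0 ≤ e := (mean_nonneg hp0 hp1 m _ hind).trans he
  set G := e / (1 - φ) with hG
  have hG0 : 0 ≤ G := by positivity
  have hGC : G = e + φ * G := by rw [hG]; field_simp; ring
  set v : NoisyTree n (Option ℕ) → ℝ := fun s =>
    s.mean p m (fun o => if o = none ∨ o = some m then 0 else 1) +
    s.mean p m (fun o => if o = none then 1 else 0) * G with hv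
  have hv0 : ∀ s, 0 ≤ v s := fun s => add_nonneg (mean_nonneg hp0 hp1 m _ hind)
    (mul_nonneg (mean_nonneg hp0 hp1 m _ fun o => by split_ifs <;> norm_num) hG0)
  have hroot : v (ask j k) ≤ G := by
    rw [hGC]; simp only [hv]; gcongr
  have hask : ∀ j' k', v (ask j' k') = (1 - p) * v (k' (decide ((j' : ℕ) < m))) +
        p * v (k' (!decide ((j' : ℕ) < m))) := by
    intro j' k'; simp only [hv, mean]; ring
  have hstep : ∀ j' k', ((restart q j k).step p a x (ask j' k')).expect
      (fun s => ENNReal.ofReal (v s)) = ENNReal.ofReal (v (ask j' k')) := by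
    intro j' k'
    rw [expect_step_restart_ask p q j k ha x j' k' v hv0, hask]
  refine ((restart q j k).errorProbability_le_expect p a x hfin (fun s => ENNReal.ofReal (v s))
    ?_ ?_).trans ?_
  · rintro (o | ⟨j', k'⟩) r hr
    · rcases o with _ | i
      · refine (hstep j k).trans_le ?_
        refine ENNReal.ofReal_le_ofReal (hroot.trans_eq ?_)
        simp [hv, mean]
      · cases hr
    · exact (hstep j' k').le
  · rintro (o | ⟨j', k'⟩) i hi hne
    · rcases o with _ | i'
      · cases hi
      · cases hi
        simp [hv, mean, hm, hne]
    · cases hi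
  · refine (expect_init_restart q j k _).trans_le ?_
    have h0 : v (leaf (some 0)) ≤ 1 := by
      simp only [hv, mean]; simp; split_ifs <;> norm_num
    have hq : 0 ≤ 1 - (q : ℝ) := by linarith [q.2.2]
    have hq0 := q.2.1
    rw [ENNReal.ofReal_add (mul_nonneg hq hG0) hq0, ENNReal.ofReal_mul hq]
    have h1 : ENNReal.ofReal (v (leaf (some 0))) ≤ 1 := by
      simpa using ENNReal.ofReal_le_ofReal h0
    calc _ ≤ ENNReal.ofReal (1 - q) * ENNReal.ofReal G + ENNReal.ofReal q * 1 := by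
          gcongr
      _ = _ := by rw [mul_one]

end

end NoisyTree

/-! ### Choice of the parameters. -/

theorem bscCapacity_pos {p : ℝ} (hp : p ≠ 1 / 2) : 0 < bscCapacity p := by
  have h : Real.binEntropy p < Real.log 2 := Real.binEntropy_lt_log_two.2 (by simpa using hp)
  have h2 : 0 < Real.log 2 := Real.log_pos one_lt_two
  have e : bscCapacity p = (Real.log 2 - Real.binEntropy p) / Real.log 2 := by
    rw [bscCapacity, binaryEntropyBits, Real.binEntropy, Real.logb, Real.logb, Real.log_inv,
      Real.log_inv]
    field_simp
    ring
  rw [e]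
  exact div_pos (by linarith) h2

theorem logb_odds_pos {p : ℝ} (hp0 : 0 < p) (hp : p < 1 / 2) :
    0 < Real.logb 2 ((1 - p) / p) :=
  Real.logb_pos one_lt_two (by rw [lt_div_iff₀ hp0]; linarith)

theorem odds_pow_le {p : ℝ} (hp0 : 0 < p) (hp : p < 1 / 2) {y : ℝ} {A : ℕ}
    (hA : y / Real.logb 2 ((1 - p) / p) ≤ A) : (p / (1 - p)) ^ A ≤ 2 ^ (-y) := by
  have hp1 : 0 < 1 - p := by linarith
  have h := logb_odds_pos hp0 hp
  have e : p / (1 - p) = (2 : ℝ) ^ (-Real.logb 2 ((1 - p) / p)) := by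
    rw [Real.rpow_neg two_pos.le, Real.rpow_logb two_pos (by norm_num) (by positivity), inv_div]
  rw [e, ← Real.rpow_natCast, ← Real.rpow_mul two_pos.le]
  refine Real.rpow_le_rpow_of_exponent_le one_le_two ?_
  rw [div_le_iff₀ h] at hA
  linarith

/-- Bound on the probability that one round of the search has to be repeated. -/
noncomputable def restartBound (p : ℝ) (T N : ℕ) : ℝ :=
  T * (p * (1 - p) * (Real.logb 2 (1 - p) - Real.logb 2 p) ^ 2) / ((N : ℝ) ^ 4) ^ 2 +
    (2 * (N ^ 4 + 2 : ℕ) + 4) * (p / (1 - p)) ^ N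

/-- Lower-order part of the number of comparisons in one round, where `l` is the logarithm of the
number of elements. -/
noncomputable def overhead (p l : ℝ) (N : ℕ) : ℝ :=
  2 + ((N : ℝ) ^ 5 + 4 * N) / (1 - 2 * p) +
    2 * ((Real.logb 2 l + 1) / Real.logb 2 ((1 - p) / p) + 1) / (1 - 2 * p)

/-- Here `Δ = N ^ 4`. Positions that reach the threshold number at most `2 ^ (N ^ 4 + 1)` by weight,
plus at most `T` from the drift, hence `N ^ 4 + 2` halvings. -/
theorem exists_search_round {p : ℝ} (hp0 : 0 < p) (hp : p < 1 / 2) {n N T : ℕ} (hn : 0 < n)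
    (hN : 0 < N) (hT : Real.logb 2 n ≤ T * bscCapacity p) (hNl : (N : ℝ) ^ 4 < Real.logb 2 n)
    (hTN : (T : ℝ) ≤ 2 ^ (N ^ 4 + 1)) (A : ℕ) :
    ∃ t : NoisyTree n (Option ℕ), ∀ m ≤ n,
      t.cost p m ≤ T + (N ^ 4 + 2 : ℕ) * (N / (1 - 2 * p)) + 2 * ((A + N) / (1 - 2 * p)) ∧
      t.mean p m (fun o => if o = none then 1 else 0) ≤ restartBound p T N ∧
      t.mean p m (fun o => if o = none ∨ o = some m then 0 else 1) ≤ (p / (1 - p)) ^ A := by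
  have hn' : (0 : ℝ) < n := by exact_mod_cast hn
  refine NoisyTree.exists_round (Δ := (N : ℝ) ^ 4) hp0 hp hn (by positivity) A N T (N ^ 4 + 2)
    (by linarith) ?_
  have h1 : (n : ℝ) / 2 ^ N ^ 4 ≤ 2 ^ (T * bscCapacity p - (N : ℝ) ^ 4) := by
    rw [Real.rpow_sub two_pos]
    have : ((2 : ℝ) ^ ((N : ℝ) ^ 4)) = 2 ^ N ^ 4 := by
      rw [← Real.rpow_natCast 2 (N ^ 4)]; push_cast; rfl
    rw [this]
    gcongr
    calc (n : ℝ) = 2 ^ Real.logb 2 n := (Real.rpow_logb two_pos (by norm_num) hn').symm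
      _ ≤ _ := Real.rpow_le_rpow_of_exponent_le one_le_two hT
  have h2 : ((n : ℝ) + 1) / 2 ^ (T * bscCapacity p - (N : ℝ) ^ 4) ≤ 2 ^ (N ^ 4 + 1) := by
    have hn1 : (1 : ℝ) ≤ n := by exact_mod_cast hn
    calc _ ≤ ((n : ℝ) + n) / (n / 2 ^ N ^ 4) := by gcongr
      _ = _ := by field_simp; ring
  calc _ ≤ (2 : ℝ) ^ (N ^ 4 + 1) + 2 ^ (N ^ 4 + 1) := add_le_add h2 hTN
    _ = _ := by ring

theorem exists_randomizedSearch (p : unitInterval) (hp0 : 0 < (p : ℝ)) (hp : (p : ℝ) < 1 / 2)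
    {n N : ℕ} (hn : 0 < n) (hN : 0 < N) (hNl : (N : ℝ) ^ 4 < Real.logb 2 n)
    (hTN : (⌈Real.logb 2 n / bscCapacity p⌉₊ : ℝ) ≤ 2 ^ (N ^ 4 + 1))
    (hφ : restartBound p ⌈Real.logb 2 n / bscCapacity p⌉₊ N ≤ 1 / 2) {δ : ℝ} (hδ0 : 0 < δ)
    (hδ1 : δ < 1) :
    ∃ A : RandomizedSearch n,
      ∀ (α : Type*) [LinearOrder α] (a : Fin n → α) (x : α), Monotone a →
        A.errorProbability p a x ≤ ENNReal.ofReal δ ∧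
        A.expectedQueries p a x ≤ ENNReal.ofReal
          ((1 + overhead p (Real.logb 2 n) N * bscCapacity p / Real.logb 2 n) /
            ((1 - 1 / Real.logb 2 n) *
              (1 - restartBound p ⌈Real.logb 2 n / bscCapacity p⌉₊ N)) *
            ((1 - δ) * Real.logb 2 n / bscCapacity p + 2 * Real.logb 2 (1 / δ) /
              ((1 - 2 * p) * Real.logb 2 ((1 - p) / p)))) := by
  have hp1 : 0 < 1 - (p : ℝ) := by linarith
  have hq2 : 0 < 1 - 2 * (p : ℝ) := by linarith
  have hI := bscCapacity_pos hp.ne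
  have hlam := logb_odds_pos hp0 hp
  set I := bscCapacity p
  set l := Real.logb 2 n
  set lam := Real.logb 2 ((1 - (p : ℝ)) / p) with hlam'
  set T := ⌈l / I⌉₊
  set φ := restartBound p T N
  have hN1 : (1 : ℝ) ≤ N := by exact_mod_cast hN
  have hl1 : 1 < l := lt_of_le_of_lt (one_le_pow₀ hN1) hNl
  have hl0 : 0 < l := by linarith
  -- The error aimed at by the rounds: negligible against `δ`, while its extra cost is only of order
  -- `log l`.
  set δ' := δ / l with hδ'
  have hδ'0 : 0 < δ' := by positivity
  have hδ'δ : δ' ≤ δ := div_le_self hδ0.le hl1.le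
  have hδ'l : δ' ≤ 1 / l := by rw [hδ']; gcongr
  have h1l : 1 / l < 1 := by rw [div_lt_one hl0]; exact hl1
  have h1δ' : 0 < 1 - δ' := by linarith
  set y := Real.logb 2 (1 / δ) with hy
  have hy0 : 0 ≤ y := Real.logb_nonneg one_lt_two (by rw [le_div_iff₀ hδ0]; linarith)
  have hL0 : 0 < Real.logb 2 l := Real.logb_pos one_lt_two hl1
  -- This makes `r ^ A ≤ δ' / 2`; the spare factor 2 absorbs the restarts, since `1 - φ ≥ 1 / 2`.
  set A := ⌈(y + Real.logb 2 l + 1) / lam⌉₊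
  have hA : (A : ℝ) ≤ (y + Real.logb 2 l + 1) / lam + 1 :=
    (Nat.ceil_lt_add_one (by positivity)).le
  have hT : (T : ℝ) ≤ l / I + 1 := (Nat.ceil_lt_add_one (by positivity)).le
  have hTI : l ≤ T * I := by rw [← div_le_iff₀ hI]; exact Nat.le_ceil _
  have hrA : ((p : ℝ) / (1 - p)) ^ A ≤ δ' / 2 := by
    refine (odds_pow_le hp0 hp (Nat.le_ceil _)).trans_eq ?_
    rw [neg_add, neg_add, Real.rpow_add two_pos, Real.rpow_add two_pos, Real.rpow_neg two_pos.le,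
      Real.rpow_neg two_pos.le, Real.rpow_logb two_pos (by norm_num) (by positivity),
      Real.rpow_logb two_pos (by norm_num) hl0, Real.rpow_neg two_pos.le, Real.rpow_one, hδ']
    field_simp
  obtain ⟨t, ht⟩ := exists_search_round hp0 hp hn hN hTI hNl hTN A
  -- The solution of `q + (1 - q) * δ' = δ`.
  set q : ℝ := 1 - (1 - δ) / (1 - δ') with hq
  have hq0 : 0 ≤ q := by
    rw [hq, sub_nonneg, div_le_one h1δ']; linarith
  have hq1 : q ≤ 1 := by
    rw [hq]; have : 0 ≤ (1 - δ) / (1 - δ') := div_nonneg (by linarith) h1δ'.le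
    linarith
  -- A restartable tree must begin with a question, so a dummy one with ignored answer is put on
  -- top, at the price of one comparison per round.
  refine ⟨NoisyTree.restart ⟨q, hq0, hq1⟩ ⟨0, hn⟩ fun _ => t, fun α _ a x ha => ?_⟩
  obtain ⟨hc, hnone, hwrong⟩ := ht _ (predecessorIndex_le a x)
  have hmean : ∀ f, (NoisyTree.ask ⟨0, hn⟩ fun _ => t).mean p (predecessorIndex a x) f =
      t.mean p (predecessorIndex a x) f := by
    intro f; simp only [NoisyTree.mean]; ring
  have hcost : (NoisyTree.ask ⟨0, hn⟩ fun _ => t).cost p (predecessorIndex a x) =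
      1 + t.cost p (predecessorIndex a x) := by
    simp only [NoisyTree.cost]; ring
  have h1q : 1 - q = (1 - δ) / (1 - δ') := by rw [hq]; ring
  have hφ1 : 0 < 1 - φ := by linarith
  constructor
  · refine (NoisyTree.restart_errorProbability_le ha x (by linarith : φ < 1)
      ((hmean _).trans_le hnone) ((hmean _).trans_le (hwrong.trans hrA))).trans ?_
    refine ENNReal.ofReal_le_ofReal ?_
    have h2 : δ' / 2 / (1 - φ) ≤ δ' := by
      rw [div_le_iff₀ hφ1]; nlinarith
    calc (1 - q) * (δ' / 2 / (1 - φ)) + q ≤ (1 - q) * δ' + q := by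
          have : 0 ≤ 1 - q := by linarith
          gcongr
      _ = 1 - (1 - q) * (1 - δ') := by ring
      _ = δ := by rw [h1q, div_mul_cancel₀ _ h1δ'.ne']; ring
  · refine (NoisyTree.restart_expectedQueries_le ha x (by linarith : φ < 1)
      (hcost.trans_le (add_le_add_right hc 1)) ((hmean _).trans_le hnone)).trans ?_
    refine ENNReal.ofReal_le_ofReal ?_
    change (1 - q) * _ ≤ _
    set E := overhead p l N with hE
    have hE0 : 0 ≤ E := by rw [hE, overhead]; positivity
    set Y := 2 * y / ((1 - 2 * (p : ℝ)) * lam) with hY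
    have hY0 : 0 ≤ Y := by positivity
    have hC : 1 + (T + (N ^ 4 + 2 : ℕ) * (N / (1 - 2 * (p : ℝ))) +
        2 * ((A + N) / (1 - 2 * (p : ℝ)))) ≤ l / I + E + Y := by
      calc _ ≤ 1 + (l / I + 1 + (N ^ 4 + 2 : ℕ) * (N / (1 - 2 * (p : ℝ))) +
            2 * (((y + Real.logb 2 l + 1) / lam + 1 + N) / (1 - 2 * (p : ℝ)))) := by gcongr
        _ = _ := by
          rw [hE, hY, overhead, ← hlam']
          have := hq2.ne'
          push_cast
          have e : 2 * y / ((1 - 2 * (p : ℝ)) * lam) = 2 * (y / lam) / (1 - 2 * (p : ℝ)) := by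
            field_simp
          rw [e]
          ring
    have h1δ : 0 ≤ 1 - δ := by linarith
    have h1l' : 0 < 1 - 1 / l := by linarith
    calc (1 - q) * ((1 + (T + (N ^ 4 + 2 : ℕ) * (N / (1 - 2 * (p : ℝ))) +
          2 * ((A + N) / (1 - 2 * (p : ℝ))))) / (1 - φ))
        ≤ (1 - δ) / (1 - 1 / l) * ((l / I + E + Y) / (1 - φ)) := by
          rw [h1q]; gcongr
      _ = 1 / ((1 - 1 / l) * (1 - φ)) * ((1 - δ) * (l / I + E) + (1 - δ) * Y) := by
          field_simp
      -- The factor `1 - δ` is given up on the verification term, so that both terms share one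
      -- factor independent of `δ`.
      _ ≤ 1 / ((1 - 1 / l) * (1 - φ)) * ((1 - δ) * (l / I + E) + (1 + E * I / l) * Y) := by
          gcongr
          have : 0 ≤ E * I / l := by positivity
          linarith
      _ = (1 + E * I / l) / ((1 - 1 / l) * (1 - φ)) * ((1 - δ) * l / I + Y) := by
          have : (1 - δ) * (l / I + E) = (1 + E * I / l) * ((1 - δ) * l / I) := by
            field_simp
          rw [this]; ring

/-! ### Limits as the number of elements grows. -/

section Asymptotics

theorem tendsto_logb_natCast_atTop : Tendsto (fun n : ℕ => Real.logb 2 n) atTop atTop :=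
  (Real.tendsto_logb_atTop one_lt_two).comp tendsto_natCast_atTop_atTop

/-- With `N` of order `l ^ (1/6)`, the deviation `N ^ 4` is of order `l ^ (2/3)`, well above the
standard deviation `√l`, while the binary search costs of order `N ^ 5`, that is `l ^ (5/6)`, which
is `o(l)`. -/
theorem tendsto_ceil_rpow_atTop : Tendsto (fun l : ℝ => ⌈l ^ (1 / 6 : ℝ)⌉₊) atTop atTop :=
  tendsto_nat_ceil_atTop.comp (tendsto_rpow_atTop (by norm_num))

theorem rpow_sixth_pow {l : ℝ} (hl : 0 ≤ l) : (l ^ (1 / 6 : ℝ)) ^ 6 = l := by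
  rw [← Real.rpow_natCast, ← Real.rpow_mul hl]; norm_num

theorem le_ceil_rpow_pow {l : ℝ} (hl : 0 ≤ l) : l ≤ (⌈l ^ (1 / 6 : ℝ)⌉₊ : ℝ) ^ 6 := by
  calc l = (l ^ (1 / 6 : ℝ)) ^ 6 := (rpow_sixth_pow hl).symm
    _ ≤ _ := by gcongr; exact Nat.le_ceil _

theorem tendsto_ceil_rpow_pow_div :
    Tendsto (fun l : ℝ => (⌈l ^ (1 / 6 : ℝ)⌉₊ : ℝ) ^ 5 / l) atTop (𝓝 0) := by
  have h : Tendsto (fun l : ℝ => 32 / l ^ (1 / 6 : ℝ)) atTop (𝓝 0) :=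
    Tendsto.const_div_atTop (tendsto_rpow_atTop (by norm_num)) 32
  refine tendsto_of_tendsto_of_tendsto_of_le_of_le' tendsto_const_nhds h ?_ ?_
  · filter_upwards [eventually_ge_atTop 0] with l hl
    positivity
  · filter_upwards [eventually_ge_atTop 1] with l hl
    have hl0 : 0 < l := by linarith
    set y := l ^ (1 / 6 : ℝ) with hy
    have hy1 : 1 ≤ y := Real.one_le_rpow hl (by norm_num)
    have hN : (⌈y⌉₊ : ℝ) ≤ 2 * y := (Nat.ceil_lt_add_one (by linarith)).le.trans (by linarith)
    rw [div_le_div_iff₀ hl0 (by linarith)]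
    calc (⌈y⌉₊ : ℝ) ^ 5 * y ≤ (2 * y) ^ 5 * y := by gcongr
      _ = 32 * y ^ 6 := by ring
      _ = 32 * l := by rw [hy, rpow_sixth_pow hl0.le]

theorem tendsto_ceil_rpow_div :
    Tendsto (fun l : ℝ => (⌈l ^ (1 / 6 : ℝ)⌉₊ : ℝ) / l) atTop (𝓝 0) := by
  refine tendsto_of_tendsto_of_tendsto_of_le_of_le' tendsto_const_nhds
    tendsto_ceil_rpow_pow_div ?_ ?_
  · filter_upwards [eventually_ge_atTop 0] with l hl
    positivity
  · filter_upwards [eventually_ge_atTop 0, tendsto_ceil_rpow_atTop.eventually_ge_atTop 1]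
      with l hl hN
    gcongr
    exact le_self_pow₀ (by exact_mod_cast hN) (by norm_num)

theorem tendsto_logb_div_self : Tendsto (fun l : ℝ => Real.logb 2 l / l) atTop (𝓝 0) := by
  have h := (Real.isLittleO_log_id_atTop.tendsto_div_nhds_zero).div_const (Real.log 2)
  rw [zero_div] at h
  refine h.congr fun l => ?_
  simp only [Real.logb, id]
  ring

theorem tendsto_overhead_div (p : ℝ) :
    Tendsto (fun l : ℝ => overhead p l ⌈l ^ (1 / 6 : ℝ)⌉₊ * bscCapacity p / l) atTop (𝓝 0) := by
  have hinv : Tendsto (fun l : ℝ => 1 / l) atTop (𝓝 0) :=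
    Tendsto.const_div_atTop tendsto_id 1
  have h := (((hinv.const_mul 2).add ((tendsto_ceil_rpow_pow_div.add
    (tendsto_ceil_rpow_div.const_mul 4)).div_const (1 - 2 * p))).add
    (((((tendsto_logb_div_self.add hinv).div_const (Real.logb 2 ((1 - p) / p))).add hinv).const_mul
      2).div_const (1 - 2 * p))).mul_const (bscCapacity p)
  simp only [mul_zero, add_zero, zero_div, zero_mul] at h
  refine h.congr fun l => ?_
  unfold overhead
  ring

/-- The Chebyshev term is `O(N ^ 6 / N ^ 8)` because `l ≤ N ^ 6`; in the other term a geometric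
factor beats a polynomial. -/
theorem tendsto_restartBound {p : ℝ} (hp0 : 0 < p) (hp : p < 1 / 2) :
    Tendsto (fun l : ℝ => restartBound p ⌈l / bscCapacity p⌉₊ ⌈l ^ (1 / 6 : ℝ)⌉₊) atTop
      (𝓝 0) := by
  have hp1 : 0 < 1 - p := by linarith
  have hI := bscCapacity_pos hp.ne
  set s := p * (1 - p) * (Real.logb 2 (1 - p) - Real.logb 2 p) ^ 2 with hs
  have hs0 : 0 ≤ s := by positivity
  have hr0 : 0 ≤ p / (1 - p) := by positivity
  have hr1 : p / (1 - p) < 1 := by rw [div_lt_one hp1]; linarith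
  have h1 : Tendsto (fun l : ℝ => (⌈l / bscCapacity p⌉₊ : ℝ) * s /
      ((⌈l ^ (1 / 6 : ℝ)⌉₊ : ℝ) ^ 4) ^ 2) atTop (𝓝 0) := by
    have hsq : Tendsto (fun l : ℝ => (⌈l ^ (1 / 6 : ℝ)⌉₊ : ℝ) ^ 2) atTop atTop :=
      (tendsto_pow_atTop two_ne_zero).comp
        (tendsto_natCast_atTop_atTop.comp tendsto_ceil_rpow_atTop)
    refine tendsto_of_tendsto_of_tendsto_of_le_of_le' tendsto_const_nhds
      (Tendsto.const_div_atTop hsq ((1 / bscCapacity p + 1) * s)) ?_ ?_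
    · exact Eventually.of_forall fun l => by positivity
    · filter_upwards [eventually_ge_atTop 0, tendsto_ceil_rpow_atTop.eventually_ge_atTop 1]
        with l hl hN
      have hN1 : (1 : ℝ) ≤ ⌈l ^ (1 / 6 : ℝ)⌉₊ := by exact_mod_cast hN
      have hlN := le_ceil_rpow_pow hl
      set N : ℝ := (⌈l ^ (1 / 6 : ℝ)⌉₊ : ℝ)
      have hT : (⌈l / bscCapacity p⌉₊ : ℝ) ≤ (1 / bscCapacity p + 1) * N ^ 6 := by
        have h6 : 1 ≤ N ^ 6 := one_le_pow₀ hN1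
        calc (⌈l / bscCapacity p⌉₊ : ℝ) ≤ l / bscCapacity p + 1 :=
              (Nat.ceil_lt_add_one (by positivity)).le
          _ ≤ N ^ 6 / bscCapacity p + N ^ 6 := by gcongr
          _ = _ := by ring
      calc _ ≤ (1 / bscCapacity p + 1) * N ^ 6 * s / (N ^ 4) ^ 2 := by gcongr
        _ = _ := by field_simp
  have h2 : Tendsto (fun N : ℕ => (2 * (N ^ 4 + 2 : ℕ) + 4 : ℝ) * (p / (1 - p)) ^ N) atTop
      (𝓝 0) := by
    have h3 := ((tendsto_pow_const_mul_const_pow_of_lt_one 4 hr0 hr1).const_mul 2).add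
      ((tendsto_pow_atTop_nhds_zero_of_lt_one hr0 hr1).const_mul 8)
    simp only [mul_zero, add_zero] at h3
    refine h3.congr fun N => ?_
    push_cast
    ring
  have h := h1.add (h2.comp tendsto_ceil_rpow_atTop)
  rw [add_zero] at h
  exact h

theorem eventually_ceil_div_le {c : ℝ} (hc : 0 < c) :
    ∀ᶠ l : ℝ in atTop, (⌈l / c⌉₊ : ℝ) ≤ 2 ^ (⌈l ^ (1 / 6 : ℝ)⌉₊ ^ 4 + 1) := by
  have h := ((tendsto_pow_const_mul_const_pow_of_lt_one (r := 1 / 2) 6 (by norm_num)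
    (by norm_num)).const_mul (1 / c + 1)).comp tendsto_ceil_rpow_atTop
  rw [mul_zero] at h
  filter_upwards [h.eventually (gt_mem_nhds one_pos), eventually_ge_atTop 0,
    tendsto_ceil_rpow_atTop.eventually_ge_atTop 1] with l hl hl0 hN
  have hlN := le_ceil_rpow_pow hl0
  simp only [Function.comp] at hl
  set N := ⌈l ^ (1 / 6 : ℝ)⌉₊
  have hN1 : (1 : ℝ) ≤ N := by exact_mod_cast hN
  have h6 : 1 ≤ (N : ℝ) ^ 6 := one_le_pow₀ hN1
  have hN4 : N ≤ N ^ 4 + 1 := (le_self_pow₀ hN (by norm_num)).trans (Nat.le_succ _)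
  have h2 : (1 / c + 1) * (N : ℝ) ^ 6 ≤ 2 ^ N := by
    rw [one_div_pow, ← mul_assoc, mul_one_div, div_lt_one (by positivity)] at hl
    exact hl.le
  calc (⌈l / c⌉₊ : ℝ) ≤ l / c + 1 := (Nat.ceil_lt_add_one (by positivity)).le
    _ ≤ (N : ℝ) ^ 6 / c + (N : ℝ) ^ 6 := by gcongr
    _ = (1 / c + 1) * (N : ℝ) ^ 6 := by ring
    _ ≤ 2 ^ N := h2
    _ ≤ _ := pow_le_pow_right₀ one_le_two hN4

end Asymptotics

theorem theorem4 (p : unitInterval) (hp_pos : 0 < (p : ℝ)) (hp_half : (p : ℝ) < 1 / 2) :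
    ∃ ε : ℕ → ℝ, Tendsto ε atTop (𝓝 0) ∧
      ∀ᶠ n : ℕ in atTop, ∀ δ : ℝ, 0 < δ → δ < 1 →
        ∃ A : RandomizedSearch n,
          ∀ (α : Type*) [LinearOrder α] (a : Fin n → α) (x : α), Monotone a →
            A.errorProbability p a x ≤ ENNReal.ofReal δ ∧
            A.expectedQueries p a x ≤ ENNReal.ofReal ((1 + ε n) *
              ((1 - δ) * Real.logb 2 n / bscCapacity p +
                2 * Real.logb 2 (1 / δ) /
                  ((1 - 2 * p) * Real.logb 2 ((1 - p) / p)))) := by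
  have hl := tendsto_logb_natCast_atTop
  have hφ := tendsto_restartBound hp_pos hp_half
  -- `ε` is the prefactor of `exists_randomizedSearch` minus 1, read as a function of `l = log n`.
  have hε : Tendsto (fun l : ℝ =>
      (1 + overhead p l ⌈l ^ (1 / 6 : ℝ)⌉₊ * bscCapacity p / l) / ((1 - 1 / l) *
        (1 - restartBound p ⌈l / bscCapacity p⌉₊ ⌈l ^ (1 / 6 : ℝ)⌉₊)) - 1) atTop (𝓝 0) := by
    have hinv : Tendsto (fun l : ℝ => 1 / l) atTop (𝓝 0) :=
      Tendsto.const_div_atTop tendsto_id 1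
    have h := (((tendsto_overhead_div p).const_add 1).div
      ((hinv.const_sub 1).mul (hφ.const_sub 1)) (by norm_num)).sub_const 1
    rwa [show ((1 : ℝ) + 0) / ((1 - 0) * (1 - 0)) - 1 = 0 by norm_num] at h
  refine ⟨_, hε.comp hl, ?_⟩
  · have hev : ∀ᶠ l : ℝ in atTop, 0 < ⌈l ^ (1 / 6 : ℝ)⌉₊ ∧
        (⌈l ^ (1 / 6 : ℝ)⌉₊ : ℝ) ^ 4 < l ∧
        (⌈l / bscCapacity p⌉₊ : ℝ) ≤ 2 ^ (⌈l ^ (1 / 6 : ℝ)⌉₊ ^ 4 + 1) ∧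
        restartBound p ⌈l / bscCapacity p⌉₊ ⌈l ^ (1 / 6 : ℝ)⌉₊ ≤ 1 / 2 := by
      filter_upwards [tendsto_ceil_rpow_atTop.eventually_gt_atTop 0,
        tendsto_ceil_rpow_pow_div.eventually (gt_mem_nhds one_pos), eventually_gt_atTop 0,
        eventually_ceil_div_le (bscCapacity_pos hp_half.ne),
        hφ.eventually (gt_mem_nhds (by norm_num : (0 : ℝ) < 1 / 2))] with l h1 h2 h3 h4 h5
      refine ⟨h1, ?_, h4, h5.le⟩
      rw [div_lt_one h3] at h2
      exact lt_of_le_of_lt (pow_le_pow_right₀ (by exact_mod_cast h1) (by norm_num)) h2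
    filter_upwards [hl.eventually hev, eventually_gt_atTop 0] with n ⟨h1, h2, h3, h4⟩ hn δ hδ0 hδ1
    obtain ⟨A, hA⟩ := exists_randomizedSearch p hp_pos hp_half hn h1 h2 h3 h4 hδ0 hδ1
    refine ⟨A, fun α _ a x ha => ?_⟩
    simp only [Function.comp, add_sub_cancel]
    exact hA α a x ha
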